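/- Let $(S,\mathfrak n)$ be an $F$-finite regular local ring of prime characteristic $p>0$ and let $R=S/J$ be a nonzero quotient ring, with maximal ideal $\mathfrak m$. Conventions, for an $F$-finite local ring $(A,\mathfrak m_A,k)$ of characteristic $p$. Put $\alpha(A)=\log_p[k:k^p]$ and $\mathcal C^A_e=\operatorname{Hom}_A(F^e_*A,A)$. A Cartier subalgebra $\mathcal D=\bigoplus_{e\ge0}\mathcal D_e$ on $A$ is a graded subring (under composition) of $\mathcal C^A=\bigoplus_{e\ge 0}\mathcal C^A_e$ with $\mathcal D_0=\mathcal C^A_0=A$ and $\mathcal D_e\ne0$ for some $e>0$. For $e>0$, $a_e(A,\mathcal D)$ is the maximal number of summands $M_j\cong A$ in a direct sum decomposition $F^e_*A=\bigoplus_i M_i$ whose projection $F^e_*A\to M_j\cong A$ lies in $\mathcal D_e$, and $\Gamma_{\mathcal D}=\{e : a_e(A,\mathcal D)\neq0\}$. Put $P_{\mathcal D}=\{r\in A : \phi(F^e_*r)\in\mathfrak m_A \text{ for all } e>0,\ \phi\in\mathcal D_e\}$. The pair $(A,\mathcal D)$ is $F$-pure if some $\phi\in\mathcal D_e$ with $e>0$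 is surjective; in that case its splitting dimension is $\operatorname{sdim}(A,\mathcal D)=\dim(A/P_{\mathcal D})$, and its splitting ratio is $$r_F(A,\mathcal D)=\lim_{e\in\Gamma_{\mathcal D},\,e\to\infty} \frac{a_e(A,\mathcal D)}{p^{e(\dim(A/P_{\mathcal D})+\alpha(A))}}.$$ An $F$-graded system on $S$ is a sequence of ideals $\mathfrak b_\bullet=(\mathfrak b_e)_{e\ge0}$ of $S$ with $\mathfrak b_0=S$, $\mathfrak b_e\neq0$ for some $e>0$, and $\mathfrak b_e^{[p^l]}\mathfrak b_l\subseteq\mathfrak b_{e+l}$ for all $e,l\ge 0$; it defines the graded subring $\mathcal C^{\mathfrak b_\bullet}$ of $\mathcal C^S$ with $\mathcal C^{\mathfrak b_\bullet}_e=\mathcal C^S_e\cdot F^e_*\mathfrak b_e$, and the invariants of $(S,\mathfrak b_\bullet)$ are those of $(S,\mathcal C^{\mathfrak b_\bullet})$. Theorem. For every Cartier subalgebra $\mathcal D$ on $R$ there is an $F$-graded system $\mathfrak b_\bullet$ on $S$ such that $\mathcal C^{\mathfrak b_\bullet}$ is a Cartier subalgebra on $S$ that induces $\mathcal D$ (for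 every $e\ge 0$, a map $\psi\in\mathcal C^R_e$ lies in $\mathcal D_e$ if and only if it is induced by some $\phi\in\mathcal C^{\mathfrak b_\bullet}_e$), and for all $e>0$ one has $\mathfrak b_e\subseteq(J^{[p^e]}:J)$ and $$\frac{a_e(R,\mathcal D)}{p^{e\alpha(R)}}=\frac{a_e(S,\mathfrak b_\bullet)}{p^{e\alpha(S)}}=\ell_S\big(S/(\mathfrak n^{[p^e]}:\mathfrak b_e)\big)=\ell_S\big(\mathfrak b_e/(\mathfrak b_e\cap\mathfrak n^{[p^e]})\big),$$ all of these numbers being finite. In addition, $$P_{\mathcal D}=P_{\mathfrak b_\bullet}\cdot R=\Big(\bigcap_{e>0}(\mathfrak n^{[p^e]}:\mathfrak b_e)\Big)\cdot R,\qquad P_{\mathfrak b_\bullet}=\bigcap_{e>0}(\mathfrak n^{[p^e]}:\mathfrak b_e).$$ Moreover $(R,\mathcal D)$ is $F$-pure if and only if $(S,\mathfrak b_\bullet)$ is, and in that case $\operatorname{sdim}(R,\mathcal D)=\operatorname{sdim}(S,\mathfrak b_\bullet)$ and $r_F(R,\mathcal D)=r_F(S,\mathfrak b_\bullet)$, the last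 equality meaning that a value is the limit defining one side if and only if it is the limit defining the other. -/

import Mathlib

open IsLocalRing Filter Topology
open scoped ENNReal

/-- A nonzero quotient of a local ring is local. -/
instance quotientIsLocalRing {S : Type*} [CommRing S] [IsLocalRing S] (J : Ideal S)
    [Nontrivial (S ⧸ J)] : IsLocalRing (S ⧸ J) :=
  IsLocalRing.of_surjective' (Ideal.Quotient.mk J) Ideal.Quotient.mk_surjective

/-- A nonzero quotient of a ring of prime characteristic `p` has characteristic `p`. -/
instance quotientCharP {S : Type*} [CommRing S] (p : ℕ) [hp : Fact p.Prime] [CharP S p]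
    (J : Ideal S) [Nontrivial (S ⧸ J)] : CharP (S ⧸ J) p :=
  (CharP.charP_iff_prime_eq_zero hp.out).2 (by
    rw [← map_natCast (Ideal.Quotient.mk J), CharP.cast_eq_zero, map_zero])

/-- The residue field of a local ring of prime characteristic `p` has characteristic `p`. -/
instance residueFieldCharP {R : Type*} [CommRing R] [IsLocalRing R] (p : ℕ) [hp : Fact p.Prime]
    [CharP R p] : CharP (ResidueField R) p :=
  (CharP.charP_iff_prime_eq_zero hp.out).2 (by
    rw [← map_natCast (residue R), CharP.cast_eq_zero, map_zero])

/-- The underlying additive group of `F^e_* R`; it is a copy of `R`. -/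
def FPush (_p _e : ℕ) (R : Type*) : Type _ := R

namespace FPush

variable {p e : ℕ} {R : Type*} [CommRing R]

instance : AddCommGroup (FPush p e R) := inferInstanceAs (AddCommGroup R)

/-- The element `F^e_* r` of `F^e_* R`. -/
def of (p e : ℕ) {R : Type*} [CommRing R] : R ≃+ FPush p e R := AddEquiv.refl R

/-- `F^e_* R` is an `R`-module by restriction of scalars along the `e`-th iterate of Frobenius. -/
noncomputable instance [Fact p.Prime] [CharP R p] : Module R (FPush p e R) :=
  Module.compHom R (iterateFrobenius R p e)

/-- `r • F^e_* x = F^e_* (r ^ (p ^ e) * x)`. -/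
theorem smul_of [Fact p.Prime] [CharP R p] (r x : R) :
    r • of p e x = of p e (r ^ p ^ e * x) := rfl

end FPush

/-- `C^R_e = Hom_R(F^e_* R, R)`, the `p^{-e}`-linear maps on `R`. -/
abbrev CartierMap (p e : ℕ) (R : Type*) [CommRing R] [Fact p.Prime] [CharP R p] : Type _ :=
  FPush p e R →ₗ[R] R

namespace CartierMap

variable {p e f : ℕ} {R : Type*} [CommRing R] [Fact p.Prime] [CharP R p]

/-- The product `φ · ψ = φ ∘ F^e_* ψ` of the Cartier algebra; as an additive map on `R` it is
the composition of `φ` and `ψ`. -/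
noncomputable def mul (φ : CartierMap p e R) (ψ : CartierMap p f R) : CartierMap p (e + f) R where
  toFun x := φ (FPush.of p e (ψ (FPush.of p f ((FPush.of p (e + f)).symm x))))
  map_add' x y := by simp only [map_add]
  map_smul' r x := by
    obtain ⟨x, rfl⟩ := (FPush.of p (e + f)).surjective x
    rw [FPush.smul_of, AddEquiv.symm_apply_apply, AddEquiv.symm_apply_apply, pow_add, pow_mul,
      ← FPush.smul_of, map_smul, smul_eq_mul, ← FPush.smul_of, map_smul, RingHom.id_apply]

theorem mul_of (φ : CartierMap p e R) (ψ : CartierMap p f R) (x : R) :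
    φ.mul ψ (FPush.of p (e + f) x) = φ (FPush.of p e (ψ (FPush.of p f x))) := rfl

/-- The map `φ(F^e_* b · _)`. -/
noncomputable def premul (φ : CartierMap p e R) (b : R) : CartierMap p e R where
  toFun x := φ (FPush.of p e (b * (FPush.of p e).symm x))
  map_add' x y := by simp only [map_add, mul_add]
  map_smul' r x := by
    obtain ⟨x, rfl⟩ := (FPush.of p e).surjective x
    rw [FPush.smul_of, AddEquiv.symm_apply_apply, AddEquiv.symm_apply_apply, mul_left_comm,
      ← FPush.smul_of, map_smul, RingHom.id_apply]

theorem premul_of (φ : CartierMap p e R) (b x : R) :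
    φ.premul b (FPush.of p e x) = φ (FPush.of p e (b * x)) := rfl

end CartierMap

/-- A graded subring `D = ⊕ D_e` of the Cartier algebra `C^R = ⊕ Hom_R(F^e_* R, R)` with
`D_0 = C_0 = Hom_R(R, R)`, given by its homogeneous pieces. (Each piece is then automatically an
`R`-submodule, and `D` is automatically an algebra over the prime field.) -/
structure GradedCartierSubring (p : ℕ) (R : Type*) [CommRing R] [Fact p.Prime] [CharP R p] where
  /-- the homogeneous piece `D_e` -/
  deg : (e : ℕ) → Submodule R (CartierMap p e R)
  deg_zero : deg 0 = ⊤
  mul_mem : ∀ {e f : ℕ} {φ : CartierMap p e R} {ψ : CartierMap p f R},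
    φ ∈ deg e → ψ ∈ deg f → φ.mul ψ ∈ deg (e + f)

/-- A Cartier subalgebra on `R`: additionally `D_e ≠ 0` for some `e > 0`. -/
structure CartierSubalgebra (p : ℕ) (R : Type*) [CommRing R] [Fact p.Prime] [CharP R p] extends
    GradedCartierSubring p R where
  exists_ne_bot : ∃ e, 0 < e ∧ deg e ≠ ⊥

/-- `R` is `F`-finite: `F_* R` is a finitely generated `R`-module. -/
def IsFFinite (p : ℕ) (R : Type*) [CommRing R] [Fact p.Prime] [CharP R p] : Prop :=
  Module.Finite R (FPush p 1 R)

/-- `α(R) = log_p [k : k^p]`, where `k` is the residue field of `R`. -/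
noncomputable def frobAlpha (p : ℕ) (R : Type*) [CommRing R] [IsLocalRing R] [Fact p.Prime]
    [CharP R p] : ℝ :=
  Real.logb p (Module.finrank (frobenius (ResidueField R) p).fieldRange (ResidueField R))

namespace GradedCartierSubring

variable {p : ℕ} {R : Type*} [CommRing R] [Fact p.Prime] [CharP R p]

theorem premul_mem (D : GradedCartierSubring p R) {e : ℕ} {φ : CartierMap p e R}
    (h : φ ∈ D.deg e) (r : R) : φ.premul r ∈ D.deg e := by
  let ψ : CartierMap p 0 R :=
    { toFun := fun x => r * (FPush.of p 0).symm x
      map_add' := fun x y => by simp only [map_add, mul_add]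
      map_smul' := fun s x => by
        obtain ⟨x, rfl⟩ := (FPush.of p 0).surjective x
        rw [FPush.smul_of, AddEquiv.symm_apply_apply, AddEquiv.symm_apply_apply, pow_zero,
          pow_one, mul_left_comm, RingHom.id_apply, smul_eq_mul] }
  have hψ : ψ ∈ D.deg 0 := by rw [D.deg_zero]; exact Submodule.mem_top
  exact D.mul_mem h hψ

/-- In the internal direct sum decomposition `F^e_* R = ⊕ M_i`, the summand `M_j` is a
`D`-summand: there is an isomorphism `θ : M_j ≃ R` such that the projection onto `M_j` followed
by `θ`, i.e. the map that is `θ` on `M_j` and `0` on all other summands, belongs to `D_e`. -/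
def IsDSummand (D : GradedCartierSubring p R) (e : ℕ) {m : ℕ}
    (M : Fin m → Submodule R (FPush p e R)) (j : Fin m) : Prop :=
  ∃ θ : M j ≃ₗ[R] R, ∃ φ ∈ D.deg e,
    (∀ x : M j, φ x = θ x) ∧ ∀ i, i ≠ j → ∀ x ∈ M i, φ x = 0

/-- The `e`-th `F`-splitting number of `(R, D)`: the maximal number of `D`-summands in the direct
sum decompositions of `F^e_* R`. (The supremum is taken in `ℕ∞`.) -/
noncomputable def splittingNumber (D : GradedCartierSubring p R) (e : ℕ) : ℕ∞ :=
  sSup {n : ℕ∞ | ∃ (m : ℕ) (M : Fin m → Submodule R (FPush p e R)) (s : Finset (Fin m)),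
    DirectSum.IsInternal M ∧ (∀ j ∈ s, D.IsDSummand e M j) ∧ n = s.card}

/-- `(R, D)` is `F`-pure: some `φ ∈ D_e` with `e > 0` is surjective. -/
def IsFPure (D : GradedCartierSubring p R) : Prop :=
  ∃ e, 0 < e ∧ ∃ φ ∈ D.deg e, Function.Surjective φ

/-- The ideal `P_D` of all `r` with `φ(F^e_* r) ∈ m` for all `e > 0` and all `φ ∈ D_e`. -/
def splittingPrime [IsLocalRing R] (D : GradedCartierSubring p R) : Ideal R where
  carrier := {r | ∀ e, 0 < e → ∀ φ ∈ D.deg e, φ (FPush.of p e r) ∈ maximalIdeal R}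
  zero_mem' := fun e _ φ _ => by rw [map_zero, map_zero]; exact Ideal.zero_mem _
  add_mem' := fun {a b} ha hb e he φ hφ => by
    rw [map_add, map_add]; exact Ideal.add_mem _ (ha e he φ hφ) (hb e he φ hφ)
  smul_mem' := fun c x hx e he φ hφ => hx e he (φ.premul c) (D.premul_mem hφ c)

/-- The `F`-splitting dimension `dim(R / P_D)` (meant for `F`-pure `(R, D)`). -/
noncomputable def splittingDim [IsLocalRing R] (D : GradedCartierSubring p R) : WithBot ℕ∞ :=
  ringKrullDim (R ⧸ D.splittingPrime)

/-- The semigroup of `D`: the set of all `e` with nonzero splitting number. -/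
def semigroup (D : GradedCartierSubring p R) : Set ℕ := {e | D.splittingNumber e ≠ 0}

/-- `r` is the `F`-splitting ratio of `(R, D)`: with `d = dim(R / P_D)`, it is the limit of
`a_e / p^{e (d + α(R))}` as `e → ∞` in the semigroup of `D`. -/
def IsSplittingRatio [IsLocalRing R] (D : GradedCartierSubring p R) (r : ℝ≥0∞) : Prop :=
  ∃ d : ℕ, D.splittingDim = d ∧
    Tendsto (fun e : ℕ => (D.splittingNumber e : ℝ≥0∞) /
        (p : ℝ≥0∞) ^ ((e : ℝ) * ((d : ℝ) + frobAlpha p R)))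
      (atTop ⊓ 𝓟 D.semigroup) (𝓝 r)

end GradedCartierSubring

/-- The Frobenius power `I^[p^e]`, generated by the `p^e`-th powers of the elements of `I`. -/
noncomputable def frobPower (p : ℕ) {S : Type*} [CommRing S] [Fact p.Prime] [CharP S p]
    (I : Ideal S) (e : ℕ) : Ideal S :=
  I.map (iterateFrobenius S p e)

/-- An `F`-graded system of ideals of `S`. -/
structure FGradedSystem (p : ℕ) (S : Type*) [CommRing S] [Fact p.Prime] [CharP S p] where
  /-- the ideal `b_e` -/
  ideal : ℕ → Ideal S
  ideal_zero : ideal 0 = ⊤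
  exists_ne_bot : ∃ e, 0 < e ∧ ideal e ≠ ⊥
  mul_le : ∀ e l : ℕ, frobPower p (ideal e) l * ideal l ≤ ideal (e + l)

namespace FGradedSystem

variable {p : ℕ} {S : Type*} [CommRing S] [Fact p.Prime] [CharP S p]

/-- `C^S_e · F^e_* b`: all finite sums of maps `φ(F^e_* b · _)` with `φ ∈ C^S_e`, `b ∈ b_e`. -/
noncomputable def cartierDeg (b : FGradedSystem p S) (e : ℕ) : Submodule S (CartierMap p e S) :=
  Submodule.span S {ψ | ∃ φ : CartierMap p e S, ∃ c ∈ b.ideal e, ψ = φ.premul c}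

/-- The graded Cartier algebra `C^b = ⊕ C^S_e · F^e_* b_e` on `S` defined by `b`. -/
noncomputable def cartier (b : FGradedSystem p S) : GradedCartierSubring p S where
  deg := b.cartierDeg
  deg_zero := by
    rw [eq_top_iff]
    intro φ _
    refine Submodule.subset_span ⟨φ, 1, by rw [b.ideal_zero]; exact Submodule.mem_top, ?_⟩
    ext x
    obtain ⟨x, rfl⟩ := (FPush.of p 0).surjective x
    rw [CartierMap.premul_of, one_mul]
  mul_mem := by
    intro e f φ ψ hφ hψ
    have add_left : ∀ (φ₁ φ₂ : CartierMap p e S) (ψ : CartierMap p f S),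
        (φ₁ + φ₂).mul ψ = φ₁.mul ψ + φ₂.mul ψ := fun _ _ _ => rfl
    have smul_left : ∀ (c : S) (φ : CartierMap p e S) (ψ : CartierMap p f S),
        (c • φ).mul ψ = c • φ.mul ψ := fun _ _ _ => rfl
    have add_right : ∀ (φ : CartierMap p e S) (ψ₁ ψ₂ : CartierMap p f S),
        φ.mul (ψ₁ + ψ₂) = φ.mul ψ₁ + φ.mul ψ₂ := by
      intro φ ψ₁ ψ₂
      ext x
      obtain ⟨x, rfl⟩ := (FPush.of p (e + f)).surjective x
      simp only [LinearMap.add_apply, CartierMap.mul_of, map_add]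
    -- a product of generators, the second one multiplied by a scalar
    have key : ∀ (φ : CartierMap p e S) (ψ : CartierMap p f S) (a c : S), a ∈ b.ideal e →
        c ∈ b.ideal f → ∀ t : S, (φ.premul a).mul (t • ψ.premul c) ∈ b.cartierDeg (e + f) := by
      intro φ ψ a c ha hc t
      refine Submodule.subset_span ⟨φ.mul (t • ψ), a ^ p ^ f * c, ?_, ?_⟩
      · exact b.mul_le e f (Ideal.mul_mem_mul
          (Ideal.mem_map_of_mem (iterateFrobenius S p f) ha) hc)
      · ext x
        obtain ⟨x, rfl⟩ := (FPush.of p (e + f)).surjective x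
        have h : ψ (FPush.of p f (a ^ p ^ f * (c * x))) = a * ψ (FPush.of p f (c * x)) := by
          rw [← FPush.smul_of, map_smul, smul_eq_mul]
        rw [CartierMap.mul_of, CartierMap.premul_of, CartierMap.premul_of, CartierMap.mul_of,
          LinearMap.smul_apply, LinearMap.smul_apply, CartierMap.premul_of, mul_assoc, h,
          smul_eq_mul, smul_eq_mul, mul_left_comm]
    induction hφ using Submodule.span_induction with
    | mem φ hφ =>
      obtain ⟨φ, a, ha, rfl⟩ := hφ
      induction hψ using Submodule.closure_induction with
      | zero =>
        have : (φ.premul a).mul (0 : CartierMap p f S) = 0 := by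
          have h := add_right (φ.premul a) 0 0
          rwa [add_zero, left_eq_add] at h
        rw [this]; exact Submodule.zero_mem _
      | add ψ₁ ψ₂ _ _ h₁ h₂ => rw [add_right]; exact Submodule.add_mem _ h₁ h₂
      | smul_mem t ψ hψ =>
        obtain ⟨ψ, c, hc, rfl⟩ := hψ
        exact key φ ψ a c ha hc t
    | zero => exact Submodule.zero_mem _
    | add φ₁ φ₂ _ _ h₁ h₂ => rw [add_left]; exact Submodule.add_mem _ h₁ h₂
    | smul t φ _ h => rw [smul_left]; exact Submodule.smul_mem _ t h

end FGradedSystem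

/-
Both splitting numbers are ranks of residue pairings. A system of `n` free `D`-summands of
`F^e_* A` is the same as elements `φ_i ∈ D_e` and `x_j ∈ F^e_* A` with `φ_i(x_j) ≡ δ_ij` modulo
`m_A`, so `a_e` is the length of `F^e_* A` modulo `F^e_* I_e`, where `I_e` consists of the `r` with
`φ(F^e_* r) ∈ m_A` for all `φ ∈ D_e`. As `F^e_*` multiplies lengths by `p^{e α(A)}`,
the normalised splitting number is the length of `A / I_e`, and `P_D` is the intersection of the
`I_e`.

The maps on `S` that induce elements of `D` form a Cartier subalgebra `E` on `S`. Every map on `R`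
lifts since `F^e_* S` is free, so the ideals `I_e` of `E` are the preimages of those of `D`, and all
invariants agree. Because `S` is regular, `S / n^[p^e]` is Gorenstein and hence `C^S_e` is a cyclic
`F^e_* S`-module, so that `E` is given by an `F`-graded system `b`, for which `I_e` is the colon
ideal `(n^[p^e] : b_e)`. The last length is obtained by reading the pairing
`(a, x) ↦ Φ(F^e_* (a x))` of `b_e` with `S` from the other side.
-/

section RegularLocalRing

open RingTheory.Sequence Pointwise

universe u

theorem isWeaklyRegular_cons_self_iff {S : Type u} [CommRing S] {x : S} {xs : List S} :
    IsWeaklyRegular S (x :: xs) ↔ IsSMulRegular S x ∧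
      IsWeaklyRegular (S ⧸ Ideal.span {x}) (xs.map (Ideal.Quotient.mk (Ideal.span {x}))) := by
  have he : x • (⊤ : Ideal S) = Ideal.span {x} := by
    rw [← Submodule.ideal_span_singleton_smul, smul_eq_mul, Ideal.mul_top]
  rw [isWeaklyRegular_cons_iff, (Submodule.quotEquivOfEq _ _ he).isWeaklyRegular_congr,
    ← isWeaklyRegular_map_algebraMap_iff (S ⧸ Ideal.span {x}), Ideal.Quotient.algebraMap_eq]

variable {S : Type u} [CommRing S] [IsLocalRing S]

theorem nontrivial_quotient_span_singleton {x : S} (hx : x ∈ maximalIdeal S) :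
    Nontrivial (S ⧸ Ideal.span {x}) :=
  Ideal.Quotient.nontrivial_iff.2 fun h =>
    (mem_maximalIdeal x).1 hx (Ideal.span_singleton_eq_top.1 h)

theorem ofList_cons_eq_maximalIdeal {x : S} [IsLocalRing (S ⧸ Ideal.span {x})] {xs : List S}
    (hx : x ∈ maximalIdeal S)
    (h : Ideal.ofList (xs.map (Ideal.Quotient.mk (Ideal.span {x}))) =
      maximalIdeal (S ⧸ Ideal.span {x})) :
    Ideal.ofList (x :: xs) = maximalIdeal S := by
  rw [← map_maximalIdeal_of_surjective _ Ideal.Quotient.mk_surjective, ← Ideal.map_ofList] at h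
  have := congrArg (Ideal.comap (Ideal.Quotient.mk (Ideal.span {x}))) h
  rwa [Ideal.comap_map_of_surjective' _ Ideal.Quotient.mk_surjective,
    Ideal.comap_map_of_surjective' _ Ideal.Quotient.mk_surjective, Ideal.mk_ker,
    sup_eq_left.2 ((Ideal.span_singleton_le_iff_mem _).2 hx), sup_comm, ← Ideal.ofList_cons] at this

variable [IsNoetherianRing S]

theorem exists_finset_span_sup_eq_maximalIdeal {x : S} (hx : x ∈ maximalIdeal S)
    (hx2 : x ∉ maximalIdeal S ^ 2) :
    ∃ t : Finset S, t.card + 1 = (maximalIdeal S).spanFinrank ∧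
      Ideal.span t ⊔ Ideal.span {x} = maximalIdeal S := by
  classical
  obtain ⟨t, ht, hspan⟩ := Submodule.FG.exists_span_finset_card_eq_spanFinrank
    (maximalIdeal S).fg_of_isNoetherianRing
  have htm : ∀ y ∈ t, y ∈ maximalIdeal S := fun y hy => hspan ▸ Submodule.subset_span hy
  obtain ⟨a, -, ha⟩ := Submodule.mem_span_finset.1 (hspan.symm ▸ hx)
  obtain ⟨y, hy, hay⟩ : ∃ y ∈ t, IsUnit (a y) := by
    by_contra! h
    refine hx2 ?_
    rw [← ha, pow_two]
    exact Ideal.sum_mem _ fun y hy => Ideal.mul_mem_mul ((mem_maximalIdeal _).2 (h y hy)) (htm y hy)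
  refine ⟨t.erase y, by rw [Finset.card_erase_add_one hy, ht], le_antisymm ?_ ?_⟩
  · exact sup_le (Ideal.span_le.2 fun z hz => htm z (Finset.mem_of_mem_erase hz))
      ((Ideal.span_singleton_le_iff_mem _).2 hx)
  · rw [← hspan]
    refine Ideal.span_le.2 fun z hz => ?_
    obtain rfl | hzy := eq_or_ne z y
    · have hz' : a z * z = x - ∑ w ∈ t.erase z, a w • w := by
        rw [← ha, ← Finset.add_sum_erase _ _ hy, add_sub_cancel_right, smul_eq_mul]
      refine (Ideal.unit_mul_mem_iff_mem _ hay).1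
        (hz' ▸ sub_mem ?_ (Ideal.sum_mem _ fun w hw => ?_))
      · exact Ideal.mem_sup_right (Ideal.mem_span_singleton_self x)
      · exact Ideal.mem_sup_left (Ideal.mul_mem_left _ _ (Ideal.subset_span hw))
    · exact Ideal.mem_sup_left (Ideal.subset_span (Finset.mem_erase.2 ⟨hzy, hz⟩))

theorem spanFinrank_maximalIdeal_quotient_lt {x : S} [IsLocalRing (S ⧸ Ideal.span {x})]
    (hx : x ∈ maximalIdeal S) (hx2 : x ∉ maximalIdeal S ^ 2) :
    (maximalIdeal (S ⧸ Ideal.span {x})).spanFinrank < (maximalIdeal S).spanFinrank := by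
  obtain ⟨t, ht, hspan⟩ := exists_finset_span_sup_eq_maximalIdeal hx hx2
  have hmap : maximalIdeal (S ⧸ Ideal.span {x}) =
      (Ideal.span (t : Set S)).map (Ideal.Quotient.mk (Ideal.span {x})) := by
    rw [← map_maximalIdeal_of_surjective _ Ideal.Quotient.mk_surjective, ← hspan, Ideal.map_sup,
      Ideal.map_quotient_self, sup_bot_eq]
  rw [hmap, ← ht, Nat.lt_succ_iff, ← Set.ncard_coe_finset]
  exact (Ideal.spanFinrank_map_le_of_fg _ ⟨t, rfl⟩).trans
    (Submodule.spanFinrank_span_le_ncard_of_finite t.finite_toSet)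

theorem exists_notMem_sq_notMem_minimalPrimes (h : maximalIdeal S ∉ minimalPrimes S) :
    ∃ x ∈ maximalIdeal S, x ∉ maximalIdeal S ^ 2 ∧ ∀ P ∈ minimalPrimes S, x ∉ P := by
  by_contra! hx
  have hcover : (maximalIdeal S : Set S) ⊆
      ⋃ I ∈ insert (maximalIdeal S ^ 2) (minimalPrimes S), (I : Set S) := by
    intro x hxm
    by_cases hx2 : x ∈ maximalIdeal S ^ 2
    · exact Set.mem_biUnion (Set.mem_insert _ _) hx2
    · obtain ⟨P, hP, hxP⟩ := hx x hxm hx2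
      exact Set.mem_biUnion (Set.mem_insert_of_mem _ hP) hxP
  obtain ⟨I, hI, hle⟩ := (Ideal.subset_union_prime_finite
    ((minimalPrimes.finite_of_isNoetherianRing S).insert _) (f := id)
    (maximalIdeal S ^ 2) (maximalIdeal S ^ 2) fun I hI hne _ =>
      ((Set.mem_insert_iff.1 hI).resolve_left hne).1.1).1 hcover
  rcases Set.mem_insert_iff.1 hI with rfl | hI
  · have hbot : maximalIdeal S = ⊥ := Submodule.eq_bot_of_le_smul_of_le_jacobson_bot
      (maximalIdeal S) _ (maximalIdeal S).fg_of_isNoetherianRing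
      (by rw [smul_eq_mul, ← pow_two]; exact hle) (maximalIdeal_le_jacobson _)
    exact h ⟨⟨inferInstance, bot_le⟩, fun Q _ _ => hbot ▸ bot_le⟩
  · exact h (le_antisymm (le_maximalIdeal hI.1.1.ne_top) hle ▸ hI)

theorem isDomain_of_isPrime_span_singleton {x : S} (hx : x ∈ maximalIdeal S)
    (hprime : (Ideal.span {x}).IsPrime) (hmin : ∀ P ∈ minimalPrimes S, x ∉ P) : IsDomain S := by
  obtain ⟨P, hP, hPx⟩ := Ideal.exists_minimalPrimes_le (J := Ideal.span {x}) (I := ⊥) bot_le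
  have hle : P ≤ Ideal.span {x} • P := by
    intro y hy
    obtain ⟨a, rfl⟩ := Ideal.mem_span_singleton'.1 (hPx hy)
    rw [mul_comm]
    exact Ideal.mul_mem_mul (Ideal.mem_span_singleton_self x)
      ((hP.1.1.mem_or_mem hy).resolve_right (hmin P hP))
  have hPbot : P = ⊥ := Submodule.eq_bot_of_le_smul_of_le_jacobson_bot (Ideal.span {x}) _
    P.fg_of_isNoetherianRing hle
    ((Ideal.span_singleton_le_iff_mem _).2 (maximalIdeal_le_jacobson _ hx))
  have : (⊥ : Ideal S).IsPrime := hPbot ▸ hP.1.1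
  exact IsDomain.of_bot_isPrime S

theorem isRegularLocalRing_quotient_span_singleton {S : Type u} [CommRing S] [IsRegularLocalRing S]
    {x : S} (hx : x ∈ maximalIdeal S) (hx2 : x ∉ maximalIdeal S ^ 2) :
    IsRegularLocalRing (S ⧸ Ideal.span {x}) := by
  have := nontrivial_quotient_span_singleton hx
  refine IsRegularLocalRing.of_spanFinrank_maximalIdeal_le _
    (ENat.WithBot.add_le_add_one_right_iff.1 ?_)
  calc ((maximalIdeal (S ⧸ Ideal.span {x})).spanFinrank : WithBot ℕ∞) + 1
      ≤ (maximalIdeal S).spanFinrank := by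
        exact_mod_cast spanFinrank_maximalIdeal_quotient_lt hx hx2
    _ = ringKrullDim S := (isRegularLocalRing_iff S).1 inferInstance
    _ ≤ ringKrullDim (S ⧸ Ideal.span {x}) + 1 := by
        have := ringKrullDim_le_ringKrullDim_quotient_add_card (R := S) {x} (by
          simpa [IsLocalRing.ringJacobson_eq_maximalIdeal] using hx)
        rwa [Finset.coe_singleton, Finset.card_singleton, Nat.cast_one] at this

theorem isField_of_maximalIdeal_mem_minimalPrimes (S : Type u) [CommRing S] [IsRegularLocalRing S]
    (h : maximalIdeal S ∈ minimalPrimes S) : IsField S := by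
  have hdim := (isRegularLocalRing_iff S).1 inferInstance
  rw [← maximalIdeal_height_eq_ringKrullDim, Ideal.height_eq_zero_iff.2 h] at hdim
  exact isField_iff_maximalIdeal_eq.2 ((Submodule.spanFinrank_eq_zero_iff_eq_bot
    (maximalIdeal S).fg_of_isNoetherianRing).1 (by exact_mod_cast hdim))

theorem isDomain_and_exists_isWeaklyRegular (S : Type u) [CommRing S] [IsRegularLocalRing S] :
    IsDomain S ∧ ∃ xs : List S, Ideal.ofList xs = maximalIdeal S ∧ IsWeaklyRegular S xs := by
  induction hn : (maximalIdeal S).spanFinrank using Nat.strong_induction_on generalizing S with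
  | _ n ih =>
  by_cases hmin : maximalIdeal S ∈ minimalPrimes S
  · have hfield := isField_of_maximalIdeal_mem_minimalPrimes S hmin
    exact ⟨hfield.isDomain, [],
      by rw [Ideal.ofList_nil, isField_iff_maximalIdeal_eq.1 hfield], .nil S S⟩
  obtain ⟨x, hx, hx2, hxP⟩ := exists_notMem_sq_notMem_minimalPrimes hmin
  have := isRegularLocalRing_quotient_span_singleton hx hx2
  obtain ⟨hdom, ys, hys, hyreg⟩ :=
    ih _ (hn ▸ spanFinrank_maximalIdeal_quotient_lt hx hx2) (S ⧸ Ideal.span {x}) rfl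
  have hS := isDomain_of_isPrime_span_singleton hx
    ((Ideal.Quotient.isDomain_iff_prime _).1 hdom) hxP
  have hx0 : x ≠ 0 := by rintro rfl; exact hx2 (zero_mem _)
  obtain ⟨xs, rfl⟩ := List.map_surjective_iff.2
    (Ideal.Quotient.mk_surjective (I := Ideal.span {x})) ys
  exact ⟨hS, x :: xs, ofList_cons_eq_maximalIdeal hx hys, isWeaklyRegular_cons_self_iff.2
    ⟨IsLeftCancelMulZero.mul_left_cancel_of_ne_zero hx0, hyreg⟩⟩

end RegularLocalRing

section RegularSequence

open RingTheory.Sequence Pointwise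

universe u v

variable {S : Type u} [CommRing S] [IsLocalRing S]

section Powers

variable {M : Type v} [AddCommGroup M] [Module S M] [IsNoetherian S M]

theorem isWeaklyRegular_pow_cons {x : S} {xs : List S} (hxs : ∀ y ∈ x :: xs, y ∈ maximalIdeal S)
    (h : IsWeaklyRegular M (x :: xs)) {n : ℕ} (hn : n ≠ 0) : IsWeaklyRegular M (x ^ n :: xs) := by
  have hlast := isWeaklyRegular_of_perm_of_subset_maximalIdeal h
    (List.perm_append_singleton x xs).symm hxs
  rw [isWeaklyRegular_append_iff, isWeaklyRegular_singleton_iff] at hlast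
  refine isWeaklyRegular_of_perm_of_subset_maximalIdeal (rs := xs ++ [x ^ n]) ?_
    (List.perm_append_singleton _ _) ?_
  · rw [isWeaklyRegular_append_iff, isWeaklyRegular_singleton_iff]
    exact ⟨hlast.1, hlast.2.pow n⟩
  · rw [List.forall_mem_append, List.forall_mem_singleton]
    rw [List.forall_mem_cons] at hxs
    exact ⟨hxs.2, Ideal.pow_mem_of_mem _ hxs.1 n hn.bot_lt⟩

theorem isWeaklyRegular_map_pow {xs : List S} (hxs : ∀ y ∈ xs, y ∈ maximalIdeal S)
    (h : IsWeaklyRegular M xs) {n : ℕ} (hn : n ≠ 0) : IsWeaklyRegular M (xs.map (· ^ n)) := by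
  induction xs generalizing M with
  | nil => exact .nil S M
  | cons x xs ih =>
    have hpow := (isWeaklyRegular_cons_iff _ _ _).1 (isWeaklyRegular_pow_cons hxs h hn)
    exact .cons hpow.1 (ih (List.forall_mem_of_forall_mem_cons hxs) hpow.2)

end Powers

theorem free_of_isWeaklyRegular {S : Type u} {M : Type v} [CommRing S] [IsLocalRing S]
    [IsNoetherianRing S] [AddCommGroup M] [Module S M] [Module.Finite S M] {xs : List S}
    (hxs : Ideal.ofList xs = maximalIdeal S) (hS : IsWeaklyRegular S xs)
    (hM : IsWeaklyRegular M xs) : Module.Free S M := by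
  induction hn : xs.length generalizing S M xs with
  | zero =>
    rw [List.length_eq_zero_iff.1 hn, Ideal.ofList_nil] at hxs
    let := (isField_iff_maximalIdeal_eq.2 hxs.symm).toField
    infer_instance
  | succ n ih =>
    obtain _ | ⟨x, xs⟩ := xs
    · simp at hn
    have hx : x ∈ maximalIdeal S := hxs ▸ Ideal.subset_span List.mem_cons_self
    have := nontrivial_quotient_span_singleton hx
    have := Module.finitePresentation_of_finite S M
    have : Module.Finite (S ⧸ Ideal.span {x}) (QuotSMulTop x M) :=
      Module.Finite.of_restrictScalars_finite S _ _
    rw [isWeaklyRegular_cons_self_iff] at hS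
    rw [isWeaklyRegular_cons_iff'] at hM
    refine (Module.free_quotSMulTop_iff_free S M (maximalIdeal_le_jacobson _ hx) hM.1).1
      (ih ?_ hS.2 hM.2 (by simpa using hn))
    rw [← map_maximalIdeal_of_surjective _ Ideal.Quotient.mk_surjective, ← hxs, Ideal.ofList_cons,
      Ideal.map_sup, Ideal.map_quotient_self, bot_sup_eq, Ideal.map_ofList]

theorem colon_span_pow_succ_sup {R : Type*} [CommRing R] {I m : Ideal R} {x s : R} (hx : x ∈ m)
    (hreg : IsSMulRegular (R ⧸ I) x)
    (h : (Ideal.span {x} ⊔ I).colon (m : Set R) = Ideal.span {s} ⊔ (Ideal.span {x} ⊔ I)) (n : ℕ) :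
    (Ideal.span {x ^ (n + 1)} ⊔ I).colon (m : Set R) =
      Ideal.span {x ^ n * s} ⊔ (Ideal.span {x ^ (n + 1)} ⊔ I) := by
  have cancel : ∀ k y, x ^ k * y ∈ I → y ∈ I := fun k _ hy =>
    mem_of_isSMulRegular_quotient_of_smul_mem (hreg.pow k) hy
  refine le_antisymm (fun a ha => ?_) (sup_le ?_ Ideal.le_colon)
  · rw [Submodule.mem_colon] at ha
    obtain ⟨b, i, hi, hxa⟩ := Ideal.mem_span_singleton_sup.1 (ha x hx)
    have hab : a - x ^ n * b ∈ I := cancel 1 _ (by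
      convert hi using 1; linear_combination -hxa)
    have hb : b ∈ (Ideal.span {x} ⊔ I).colon (m : Set R) := by
      refine Submodule.mem_colon.2 fun y hy => ?_
      obtain ⟨c, j, hj, hya⟩ := Ideal.mem_span_singleton_sup.1 (ha y hy)
      refine Ideal.mem_span_singleton_sup.2 ⟨c, b * y - c * x, cancel n _ ?_, by simp⟩
      convert I.sub_mem hj (I.mul_mem_left y hab) using 1; linear_combination -hya
    rw [h] at hb
    obtain ⟨d, t, ht, rfl⟩ := Ideal.mem_span_singleton_sup.1 hb
    obtain ⟨c, j, hj, rfl⟩ := Ideal.mem_span_singleton_sup.1 ht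
    refine Ideal.mem_span_singleton_sup.2 ⟨d, _, Ideal.mem_span_singleton_sup.2
      ⟨c, _, I.add_mem (I.mul_mem_left (x ^ n) hj) hab, rfl⟩, by ring⟩
  · rw [Ideal.span_singleton_le_iff_mem, Submodule.mem_colon]
    intro y hy
    have hs : s ∈ (Ideal.span {x} ⊔ I).colon (m : Set R) :=
      h ▸ Ideal.mem_sup_left (Ideal.mem_span_singleton_self s)
    obtain ⟨c, j, hj, hsy⟩ := Ideal.mem_span_singleton_sup.1 (Submodule.mem_colon.1 hs y hy)
    refine Ideal.mem_span_singleton_sup.2 ⟨c, x ^ n * j, I.mul_mem_left _ hj, ?_⟩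
    linear_combination x ^ n * hsy

theorem exists_mul_notMem_mul_mem_colon {R : Type*} [CommRing R] {I m : Ideal R} {N : ℕ}
    (hI : m ^ N ≤ I) {a : R} (ha : a ∉ I) : ∃ r, r * a ∉ I ∧ r * a ∈ I.colon (m : Set R) := by
  have key : ∀ N, (∀ r ∈ m ^ N, r * a ∈ I) → ∃ r, r * a ∉ I ∧ r * a ∈ I.colon (m : Set R) := by
    intro N hN
    induction N with
    | zero => exact absurd (by simpa using hN 1) ha
    | succ N ih =>
      by_cases h : ∀ r ∈ m ^ N, r * a ∈ I
      · exact ih h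
      push Not at h
      obtain ⟨r, hr, hra⟩ := h
      refine ⟨r, hra, Submodule.mem_colon.2 fun y hy => ?_⟩
      convert hN (r * y) (pow_succ m N ▸ Ideal.mul_mem_mul hr hy) using 1
      rw [smul_eq_mul, mul_right_comm]
  exact key N fun r hr => I.mul_mem_right a (hI hr)

theorem exists_forall_notMem_exists_mul_sub_mem {I : Ideal S} {N : ℕ} (hN : maximalIdeal S ^ N ≤ I)
    (hI : I ≠ ⊤) {s : S} (hs : I.colon (maximalIdeal S : Set S) = Ideal.span {s} ⊔ I) :
    s ∉ I ∧ ∀ a ∉ I, ∃ r, r * a - s ∈ I := by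
  have hunit : ∀ a ∉ I, ∃ r c, r * a - c * s ∈ I ∧ IsUnit c := by
    intro a ha
    obtain ⟨r, hr, hrm⟩ := exists_mul_notMem_mul_mem_colon hN ha
    rw [hs] at hrm
    obtain ⟨c, i, hi, hci⟩ := Ideal.mem_span_singleton_sup.1 hrm
    have hsm : s ∈ I.colon (maximalIdeal S : Set S) :=
      hs ▸ Ideal.mem_sup_left (Ideal.mem_span_singleton_self s)
    refine ⟨r, c, by rwa [← hci, add_sub_cancel_left], by_contra fun hc => hr ?_⟩
    rw [← hci, mul_comm c]
    exact I.add_mem (Submodule.mem_colon.1 hsm c ((mem_maximalIdeal c).2 hc)) hi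
  constructor
  · intro hsI
    obtain ⟨r, hr, hrm⟩ := exists_mul_notMem_mul_mem_colon hN ((Ideal.ne_top_iff_one I).1 hI)
    rw [hs, sup_eq_right.2 ((Ideal.span_singleton_le_iff_mem I).2 hsI)] at hrm
    exact hr hrm
  · intro a ha
    obtain ⟨r, c, hrc, hc⟩ := hunit a ha
    obtain ⟨u, rfl⟩ := hc
    refine ⟨↑u⁻¹ * r, ?_⟩
    convert I.mul_mem_left (↑u⁻¹ : S) hrc using 1
    rw [mul_sub, mul_assoc, Units.inv_mul_cancel_left]

variable [IsNoetherianRing S]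

theorem isSMulRegular_quotient_ofList_append_map_pow {x : S} {xs ys : List S}
    (hmem : ∀ y ∈ ys ++ x :: xs, y ∈ maximalIdeal S) (hreg : IsWeaklyRegular S (ys ++ x :: xs))
    {n : ℕ} (hn : n ≠ 0) :
    IsSMulRegular (S ⧸ Ideal.ofList (ys ++ xs.map (· ^ n))) x := by
  rw [List.append_cons] at hmem hreg
  have hpow : IsWeaklyRegular S ((ys ++ [x]) ++ xs.map (· ^ n)) := by
    rw [isWeaklyRegular_append_iff] at hreg ⊢
    exact ⟨hreg.1, isWeaklyRegular_map_pow (List.forall_mem_append.1 hmem).2 hreg.2 hn⟩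
  have hperm : ((ys ++ [x]) ++ xs.map (· ^ n)).Perm ((ys ++ xs.map (· ^ n)) ++ [x]) := by
    rw [List.append_assoc, List.append_assoc]
    exact List.perm_append_comm.append_left ys
  have hlast := isWeaklyRegular_of_perm_of_subset_maximalIdeal hpow hperm <| by
    rw [List.forall_mem_append] at hmem ⊢
    refine ⟨hmem.1, fun z hz => ?_⟩
    obtain ⟨y, hy, rfl⟩ := List.mem_map.1 hz
    exact Ideal.pow_mem_of_mem _ (hmem.2 y hy) n hn.bot_lt
  rw [isWeaklyRegular_append_iff, isWeaklyRegular_singleton_iff, smul_eq_mul,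
    Ideal.mul_top] at hlast
  exact hlast.2

theorem colon_ofList_append_map_pow_succ {xs ys : List S}
    (hm : Ideal.ofList (ys ++ xs) = maximalIdeal S) (hreg : IsWeaklyRegular S (ys ++ xs)) (n : ℕ) :
    (Ideal.ofList (ys ++ xs.map (· ^ (n + 1)))).colon (maximalIdeal S : Set S) =
      Ideal.span {(xs.map (· ^ n)).prod} ⊔ Ideal.ofList (ys ++ xs.map (· ^ (n + 1))) := by
  induction xs generalizing ys with
  | nil =>
    rw [List.map_nil, hm, List.map_nil, List.prod_nil, Ideal.span_singleton_one, top_sup_eq,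
      Submodule.colon_eq_top_iff_subset]
  | cons x xs ih =>
    have hmem : ∀ z ∈ ys ++ x :: xs, z ∈ maximalIdeal S := fun z hz =>
      hm ▸ Ideal.subset_span hz
    have hsup : ∀ (y : S) (zs : List S),
        Ideal.ofList (ys ++ y :: zs) = Ideal.span {y} ⊔ Ideal.ofList (ys ++ zs) := fun y zs => by
      rw [Ideal.ofList_append, Ideal.ofList_cons, sup_left_comm, Ideal.ofList_append]
    have hx := ih (ys := ys ++ [x]) (by rwa [← List.append_cons]) (by rwa [← List.append_cons])
    rw [← List.append_cons, hsup] at hx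
    rw [List.map_cons, List.map_cons, List.prod_cons, hsup]
    exact colon_span_pow_succ_sup (hmem x (by simp))
      (isSMulRegular_quotient_ofList_append_map_pow hmem hreg n.succ_ne_zero) hx n

end RegularSequence

section FiniteModules

variable {S M : Type*} [CommRing S] [AddCommGroup M] [Module S M]

theorem apply_mem_of_mem_smul_top {I : Ideal S} {x : M} (hx : x ∈ (I • ⊤ : Submodule S M))
    (φ : M →ₗ[S] S) : φ x ∈ I := by
  have h := Submodule.mem_map_of_mem (f := φ) hx
  rw [Submodule.map_smul''] at h
  exact Submodule.smul_le.2 (fun r hr s _ => I.mul_mem_right s hr) h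

theorem mem_smul_top_of_forall_dual [Module.Free S M] [Module.Finite S M] {I : Ideal S} {x : M}
    (h : ∀ φ : Module.Dual S M, φ x ∈ I) : x ∈ (I • ⊤ : Submodule S M) := by
  have b := Module.Free.chooseBasis S M
  rw [← b.sum_repr x]
  exact Submodule.sum_mem _ fun i _ => Submodule.smul_mem_smul (h (b.coord i)) Submodule.mem_top

variable [IsLocalRing S] [Module.Finite S M]

variable (S M) in
theorem isFiniteLength_quotient_maximalIdeal_smul_top :
    IsFiniteLength S (M ⧸ (maximalIdeal S • ⊤ : Submodule S M)) := by
  let := Ideal.Quotient.field (maximalIdeal S)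
  have : Module.Finite (S ⧸ maximalIdeal S) (M ⧸ (maximalIdeal S • ⊤ : Submodule S M)) :=
    Module.Finite.of_restrictScalars_finite S _ _
  rw [← Module.length_ne_top_iff,
    Module.length_eq_of_surjective (R := S ⧸ maximalIdeal S) Ideal.Quotient.mk_surjective]
  exact Module.length_ne_top

theorem surjective_of_comap_smul_top_le (g : M →ₗ[S] M)
    (hg : (maximalIdeal S • ⊤ : Submodule S M).comap g ≤ maximalIdeal S • ⊤) :
    Function.Surjective g := by
  set N : Submodule S M := maximalIdeal S • ⊤
  have := (isFiniteLength_iff_isNoetherian_isArtinian.1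
    (isFiniteLength_quotient_maximalIdeal_smul_top S M)).2
  have hgN : N ≤ N.comap g := by
    rw [← Submodule.map_le_iff_le_comap, Submodule.map_smul'']
    exact smul_mono_right _ le_top
  have hinj : Function.Injective (N.mapQ N g hgN) := by
    rw [← LinearMap.ker_eq_bot, Submodule.ker_mapQ, ← le_bot_iff,
      Submodule.map_le_iff_le_comap, ← LinearMap.ker, Submodule.ker_mkQ]
    exact hg
  have hsurj := IsArtinian.surjective_of_injective_endomorphism _ hinj
  refine LinearMap.range_eq_top.1 (top_le_iff.1 ?_)
  refine Submodule.le_of_le_smul_of_le_jacobson_bot Module.Finite.fg_top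
    (maximalIdeal_le_jacobson _) fun x _ => ?_
  obtain ⟨y, hy⟩ := hsurj (Submodule.Quotient.mk x)
  obtain ⟨y, rfl⟩ := Submodule.Quotient.mk_surjective _ y
  rw [Submodule.mapQ_apply, Submodule.Quotient.eq] at hy
  rw [← sub_sub_cancel (g y) x]
  exact Submodule.sub_mem _ (Submodule.mem_sup_left ⟨y, rfl⟩) (Submodule.mem_sup_right hy)

theorem surjective_toDual_of_nondegenerate [Module.Free S M] {B : M →ₗ[S] Module.Dual S M}
    (hB : ∀ x, (∀ y, B x y ∈ maximalIdeal S) → x ∈ (maximalIdeal S • ⊤ : Submodule S M)) :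
    Function.Surjective B := by
  classical
  let ε := (Module.Free.chooseBasis S M).toDualEquiv
  have h : Function.Surjective (ε.symm.toLinearMap ∘ₗ B) := by
    refine surjective_of_comap_smul_top_le _ fun x hx => hB x fun y => ?_
    have hBx := Submodule.mem_map_of_mem (f := ε.toLinearMap) (Submodule.mem_comap.1 hx)
    rw [Submodule.map_smul''] at hBx
    have := apply_mem_of_mem_smul_top (Submodule.smul_mono le_rfl le_top hBx)
      (Module.Dual.eval S M y)
    simpa using this
  exact (Function.Surjective.of_comp_iff' ε.symm.bijective B).1 h

end FiniteModules

section Length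

open Module

variable {A B M N : Type*} [CommRing A] [CommRing B] [IsLocalRing A] [IsLocalRing B]
  [AddCommGroup M] [Module A M] [AddCommGroup N] [Module B N]

theorem length_quotient_ker_of_surjective {f : A →+* B} [IsLocalHom f] (σ : M →ₛₗ[f] N)
    (hσ : Function.Surjective σ) :
    length A (M ⧸ σ.ker) =
      length B N * length (ResidueField.map f).fieldRange (ResidueField B) := by
  let := f.toAlgebra
  let := Module.compHom N f
  have : IsScalarTower A B N := .of_algebraMap_smul fun _ _ => rfl
  have : IsLocalHom (algebraMap A B) := ‹IsLocalHom f›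
  let := (ResidueField.map f).rangeRestrictField.toAlgebra
  have : IsScalarTower (ResidueField A) (ResidueField.map f).fieldRange (ResidueField B) :=
    .of_algebraMap_eq fun _ => rfl
  let g : M →ₗ[A] N := { σ with map_smul' := σ.map_smulₛₗ }
  rw [show σ.ker = g.ker from rfl, (g.quotKerEquivOfSurjective hσ).length_eq,
    IsLocalRing.length_restrictScalars A B N, Module.length_eq_of_surjective
      (S := ResidueField A) (R := (ResidueField.map f).fieldRange)
      (ResidueField.map f).rangeRestrictField_bijective.2]

end Length

namespace FPush

variable {p e : ℕ} {R : Type*} [CommRing R] [Fact p.Prime] [CharP R p]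

variable (p e R) in
/-- The identity `F^e_* R → R`, semilinear over the `e`-th iterate of Frobenius. -/
noncomputable def toRing : FPush p e R →ₛₗ[iterateFrobenius R p e] R where
  __ := (of p e).symm.toAddMonoidHom
  map_smul' _ _ := rfl

theorem surjective_toRing : Function.Surjective (toRing p e R) := (of p e).symm.surjective

variable (p e) in
/-- The `R`-submodule `F^e_* I` of `F^e_* R`. -/
noncomputable def ideal (I : Ideal R) : Submodule R (FPush p e R) :=
  Submodule.comap (toRing p e R) I

theorem of_mem_ideal_iff {I : Ideal R} {x : R} : of p e x ∈ ideal p e I ↔ x ∈ I := Iff.rfl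

theorem smul_top_eq_ideal (I : Ideal R) :
    (I • ⊤ : Submodule R (FPush p e R)) = ideal p e (frobPower p I e) := by
  refine le_antisymm (Submodule.smul_le.2 fun r hr x _ => ?_) fun x hx => ?_
  · exact Ideal.mul_mem_right (toRing p e R x) (frobPower p I e)
      (Ideal.mem_map_of_mem (iterateFrobenius R p e) hr)
  · obtain ⟨x, rfl⟩ := (of p e).surjective x
    rw [of_mem_ideal_iff, frobPower, Ideal.map, Submodule.mem_span_set'] at hx
    obtain ⟨n, c, r, rfl⟩ := hx
    rw [map_sum]
    refine Submodule.sum_mem _ fun i _ => ?_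
    obtain ⟨a, ha, h⟩ := (r i).2
    rw [← h, smul_eq_mul, mul_comm]
    exact Submodule.smul_mem_smul ha (Submodule.mem_top (x := of p e (c i)))

end FPush

section FrobeniusDegree

theorem finrank_fieldRange_comp {K L M : Type*} [Field K] [Field L] [Field M] (f : L →+* M)
    (g : K →+* L) :
    Module.finrank (f.comp g).fieldRange M =
      Module.finrank g.fieldRange L * Module.finrank f.fieldRange M := by
  have hle : (f.comp g).fieldRange ≤ f.fieldRange := by
    rw [← RingHom.map_fieldRange]
    exact Subfield.map_le_iff_le_comap.2 fun x _ => ⟨x, rfl⟩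
  rw [← Subfield.relfinrank_mul_finrank_top hle, ← RingHom.map_fieldRange,
    RingHom.fieldRange_eq_map f, Subfield.relfinrank_map_map, Subfield.relfinrank_top_right]

theorem finrank_fieldRange_iterateFrobenius (p : ℕ) (K : Type*) [Field K] [ExpChar K p] (e : ℕ) :
    Module.finrank (iterateFrobenius K p e).fieldRange K =
      Module.finrank (frobenius K p).fieldRange K ^ e := by
  induction e with
  | zero =>
    rw [pow_zero, ← Subfield.relfinrank_top_right, Subfield.relfinrank_eq_one_iff]
    exact fun x _ => ⟨x, iterateFrobenius_zero_apply K p x⟩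
  | succ e ih =>
    rw [iterateFrobenius_add, finrank_fieldRange_comp, ih, iterateFrobenius_one, pow_succ']

theorem finite_fieldRange {K L : Type*} [Field K] [Field L] {f : K →+* L} (hf : f.Finite) :
    Module.Finite f.fieldRange L := by
  have h : RingHom.Finite f.fieldRange.subtype :=
    RingHom.Finite.of_comp_finite (f := f.rangeRestrictField) hf
  exact h

variable {p : ℕ} {R : Type*} [CommRing R] [Fact p.Prime] [CharP R p]

theorem IsFFinite.finite_frobenius (hF : IsFFinite p R) : (frobenius R p).Finite := by
  have h : (iterateFrobenius R p 1).Finite := hF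
  rwa [iterateFrobenius_one] at h

theorem IsFFinite.finite_iterateFrobenius (hF : IsFFinite p R) (e : ℕ) :
    (iterateFrobenius R p e).Finite := by
  induction e with
  | zero => rw [iterateFrobenius_zero]; exact RingHom.Finite.id R
  | succ e ih =>
    rw [iterateFrobenius_add, iterateFrobenius_one]
    exact ih.comp hF.finite_frobenius

theorem FPush.module_finite (hF : IsFFinite p R) (e : ℕ) : Module.Finite R (FPush p e R) :=
  hF.finite_iterateFrobenius e

theorem isFFinite_of_surjective {R' : Type*} [CommRing R'] [CharP R' p] {f : R →+* R'}
    (hf : Function.Surjective f) (hF : IsFFinite p R) : IsFFinite p R' := by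
  have h : ((iterateFrobenius R' p 1).comp f).Finite := by
    rw [← RingHom.iterateFrobenius_comm]
    exact (RingHom.Finite.of_surjective f hf).comp hF
  exact RingHom.Finite.of_comp_finite h

variable [IsLocalRing R]

instance : IsLocalHom (iterateFrobenius R p e) where
  map_nonunit _ h := (isUnit_pow_iff (pow_ne_zero _ (Fact.out : p.Prime).ne_zero)).1 h

theorem residueField_map_iterateFrobenius (e : ℕ) :
    ResidueField.map (iterateFrobenius R p e) = iterateFrobenius (ResidueField R) p e :=
  Ideal.Quotient.ringHom_ext (RingHom.iterateFrobenius_comm (residue R) p e).symm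

theorem rpow_mul_frobAlpha (hF : IsFFinite p R) (e : ℕ) :
    (p : ℝ≥0∞) ^ ((e : ℝ) * frobAlpha p R) =
      (Module.finrank (frobenius (ResidueField R) p).fieldRange (ResidueField R) ^ e : ℕ) := by
  have := finite_fieldRange
    (isFFinite_of_surjective (residue_surjective (R := R)) hF).finite_frobenius
  have hd := Module.finrank_pos (R := (frobenius (ResidueField R) p).fieldRange)
    (M := ResidueField R)
  have hp : (1 : ℝ) < p := by exact_mod_cast (Fact.out : p.Prime).one_lt
  have hp0 : (0 : ℝ) < p := zero_lt_one.trans hp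
  rw [← ENNReal.ofReal_natCast, ENNReal.ofReal_rpow_of_pos hp0, mul_comm, Real.rpow_mul hp0.le,
    frobAlpha, Real.rpow_logb hp0 hp.ne' (by exact_mod_cast hd), Real.rpow_natCast,
    ← Nat.cast_pow, ENNReal.ofReal_natCast]

variable (p R) in
theorem rpow_mul_frobAlpha_ne_zero (e : ℕ) :
    (p : ℝ≥0∞) ^ ((e : ℝ) * frobAlpha p R) ≠ 0 :=
  (ENNReal.rpow_pos (by exact_mod_cast (Fact.out : p.Prime).pos) (ENNReal.natCast_ne_top p)).ne'

theorem rpow_mul_frobAlpha_ne_top (hF : IsFFinite p R) (e : ℕ) :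
    (p : ℝ≥0∞) ^ ((e : ℝ) * frobAlpha p R) ≠ ⊤ := by
  rw [rpow_mul_frobAlpha hF]
  exact ENNReal.natCast_ne_top _

variable {M N : Type*} [AddCommGroup M] [Module R M] [AddCommGroup N] [Module R N]

theorem toENNReal_length_quotient_comap (hF : IsFFinite p R) {e : ℕ}
    (σ : M →ₛₗ[iterateFrobenius R p e] N) (hσ : Function.Surjective σ) (N' : Submodule R N) :
    (Module.length R (M ⧸ N'.comap σ) : ℝ≥0∞) =
      Module.length R (N ⧸ N') * (p : ℝ≥0∞) ^ ((e : ℝ) * frobAlpha p R) := by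
  have hF' := isFFinite_of_surjective (residue_surjective (R := R)) hF
  have := finite_fieldRange (hF'.finite_iterateFrobenius e)
  have hσ' : Function.Surjective (N'.mkQ.comp σ) := N'.mkQ_surjective.comp hσ
  have hker : (N'.mkQ.comp σ).ker = N'.comap σ := by rw [LinearMap.ker_comp, Submodule.ker_mkQ]
  rw [← hker, length_quotient_ker_of_surjective _ hσ', ENat.toENNReal_mul,
    residueField_map_iterateFrobenius, Module.length_eq_finrank,
    finrank_fieldRange_iterateFrobenius, rpow_mul_frobAlpha hF, ENat.toENNReal_coe]

end FrobeniusDegree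

section Generator

variable {p e : ℕ} {S : Type*} [CommRing S] [Fact p.Prime] [CharP S p]

/-- The `S`-linear map `F^e_* c ↦ φ(F^e_* c · _)`. -/
noncomputable def CartierMap.premulLinear (φ : CartierMap p e S) :
    FPush p e S →ₗ[S] CartierMap p e S where
  toFun c := φ.premul (FPush.toRing p e S c)
  map_add' c d := LinearMap.ext fun x => by
    obtain ⟨x, rfl⟩ := (FPush.of p e).surjective x
    rw [LinearMap.add_apply, premul_of, premul_of, premul_of, map_add, add_mul, map_add, map_add]
  map_smul' r c := LinearMap.ext fun x => by
    obtain ⟨c, rfl⟩ := (FPush.of p e).surjective c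
    obtain ⟨x, rfl⟩ := (FPush.of p e).surjective x
    exact (congrArg (φ ∘ FPush.of p e) (mul_assoc _ c x)).trans
      (map_smul φ r (FPush.of p e (c * x)))

theorem CartierMap.premulLinear_of (φ : CartierMap p e S) (c : S) :
    φ.premulLinear (FPush.of p e c) = φ.premul c := rfl

/-- `Φ` generates `C^S_e` as a module over `F^e_* S`. -/
def CartierMap.IsGenerator (Φ : CartierMap p e S) : Prop :=
  ∀ φ : CartierMap p e S, ∃ c, φ = Φ.premul c

theorem mem_frobPower_of_forall_apply_mem [Module.Free S (FPush p e S)]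
    [Module.Finite S (FPush p e S)] {I : Ideal S} {a : S}
    (h : ∀ φ : CartierMap p e S, φ (FPush.of p e a) ∈ I) : a ∈ frobPower p I e := by
  rw [← FPush.of_mem_ideal_iff, ← FPush.smul_top_eq_ideal]
  exact mem_smul_top_of_forall_dual h

theorem apply_mem_of_mem_frobPower (φ : CartierMap p e S) {I : Ideal S} {a : S}
    (ha : a ∈ frobPower p I e) : φ (FPush.of p e a) ∈ I := by
  rw [← FPush.of_mem_ideal_iff, ← FPush.smul_top_eq_ideal] at ha
  exact apply_mem_of_mem_smul_top ha φ

theorem frobPower_ofList (xs : List S) :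
    frobPower p (Ideal.ofList xs) e = Ideal.ofList (xs.map (· ^ p ^ e)) := by
  rw [frobPower, Ideal.map_ofList]
  rfl

variable [IsRegularLocalRing S]

theorem FPush.module_free (hF : IsFFinite p S) (e : ℕ) : Module.Free S (FPush p e S) := by
  have := module_finite hF e
  obtain ⟨_, xs, hxs, hreg⟩ := isDomain_and_exists_isWeaklyRegular S
  have hmem : ∀ y ∈ xs, y ∈ maximalIdeal S := fun y hy => hxs ▸ Ideal.subset_span hy
  refine free_of_isWeaklyRegular hxs hreg ?_
  refine ((of p e).isWeaklyRegular_congr (as := xs.map (· ^ p ^ e)) (bs := xs) ?_).1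
    (isWeaklyRegular_map_pow hmem hreg (NeZero.ne _))
  rw [List.forall₂_map_left_iff]
  exact List.forall₂_same.2 fun r _ x => rfl

variable (p e S) in
theorem exists_socle_frobPower_maximalIdeal :
    ∃ s ∉ frobPower p (maximalIdeal S) e, ∀ a ∉ frobPower p (maximalIdeal S) e,
      ∃ r, r * a - s ∈ frobPower p (maximalIdeal S) e := by
  obtain ⟨_, xs, hxs, hreg⟩ := isDomain_and_exists_isWeaklyRegular S
  have hq : p ^ e - 1 + 1 = p ^ e := Nat.sub_add_cancel (NeZero.one_le)
  have hI : frobPower p (maximalIdeal S) e = Ideal.ofList (xs.map (· ^ (p ^ e - 1 + 1))) := by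
    rw [← hxs, frobPower_ofList, hq]
  have hle : frobPower p (maximalIdeal S) e ≤ maximalIdeal S :=
    Ideal.map_le_iff_le_comap.2 fun x hx => Ideal.pow_mem_of_mem _ hx _ (NeZero.pos _)
  obtain ⟨N, hN⟩ := Ideal.exists_pow_le_of_le_radical_of_fg
    (I := maximalIdeal S) (J := frobPower p (maximalIdeal S) e)
    (fun x hx => ⟨p ^ e, Ideal.mem_map_of_mem (iterateFrobenius S p e) hx⟩)
    (IsNoetherian.noetherian _)
  refine ⟨(xs.map (· ^ (p ^ e - 1))).prod, exists_forall_notMem_exists_mul_sub_mem hN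
    (ne_top_of_le_ne_top (maximalIdeal.isMaximal S).ne_top hle) ?_⟩
  rw [hI]
  exact colon_ofList_append_map_pow_succ (ys := []) hxs hreg _

theorem exists_isGenerator (hF : IsFFinite p S) (e : ℕ) :
    ∃ Φ : CartierMap p e S, Φ.IsGenerator := by
  have := FPush.module_finite hF e
  have := FPush.module_free hF e
  obtain ⟨s, hs, hsocle⟩ := exists_socle_frobPower_maximalIdeal p e S
  obtain ⟨Φ, hΦ⟩ : ∃ Φ : CartierMap p e S, Φ (FPush.of p e s) ∉ maximalIdeal S := by
    by_contra! h
    exact hs (mem_frobPower_of_forall_apply_mem h)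
  have hnd : ∀ a, (∀ x, Φ.premulLinear a x ∈ maximalIdeal S) →
      a ∈ (maximalIdeal S • ⊤ : Submodule S (FPush p e S)) := by
    intro a ha
    obtain ⟨a, rfl⟩ := (FPush.of p e).surjective a
    rw [FPush.smul_top_eq_ideal, FPush.of_mem_ideal_iff]
    by_contra hna
    obtain ⟨r, hr⟩ := hsocle a hna
    have hrs := apply_mem_of_mem_frobPower Φ hr
    rw [map_sub, map_sub, mul_comm] at hrs
    exact hΦ ((Submodule.sub_mem_iff_right _ (ha (FPush.of p e r))).1 hrs)
  refine ⟨Φ, fun φ => ?_⟩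
  obtain ⟨c, hc⟩ := surjective_toDual_of_nondegenerate hnd φ
  exact ⟨_, hc.symm⟩

end Generator

section DualRank

variable {S X Y : Type*} [CommRing S] [IsLocalRing S] [AddCommGroup X] [Module S X]
  [AddCommGroup Y] [Module S Y] {P : X →ₗ[S] Y →ₗ[S] ResidueField S} {n : ℕ}

/-- `x` and `y` are dual systems of vectors for the pairing `P`. -/
def IsDualPair (P : X →ₗ[S] Y →ₗ[S] ResidueField S) (x : Fin n → X) (y : Fin n → Y) : Prop :=
  ∀ i j, P (x i) (y j) = if i = j then 1 else 0

/-- The rank of a pairing into the residue field: the largest size of a pair of dual systems. -/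
noncomputable def dualRank (P : X →ₗ[S] Y →ₗ[S] ResidueField S) : ℕ∞ :=
  sSup {n : ℕ∞ | ∃ m : ℕ, (∃ x y, IsDualPair (n := m) P x y) ∧ n = m}

theorem IsDualPair.flip {x : Fin n → X} {y : Fin n → Y} (h : IsDualPair P x y) :
    IsDualPair P.flip y x := fun i j => by
  simp only [LinearMap.flip_apply, h j i, eq_comm]

theorem dualRank_flip (P : X →ₗ[S] Y →ₗ[S] ResidueField S) : dualRank P.flip = dualRank P :=
  congrArg sSup (Set.ext fun _ => exists_congr fun _ => and_congr_left fun _ =>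
    ⟨fun ⟨y, x, h⟩ => ⟨x, y, h.flip⟩, fun ⟨x, y, h⟩ => ⟨y, x, h.flip⟩⟩)

variable (S) in
theorem length_pi_residueField (n : ℕ) : Module.length S (Fin n → ResidueField S) = n := by
  have : IsSimpleModule S (ResidueField S) :=
    isSimpleModule_iff_quot_maximal.2 ⟨maximalIdeal S, inferInstance, ⟨LinearEquiv.refl S _⟩⟩
  rw [Module.length_pi_of_fintype]
  simp [Module.length_eq_one]

theorem IsDualPair.le_length {x : Fin n → X} {y : Fin n → Y} (h : IsDualPair P x y) :
    n ≤ Module.length S (X ⧸ P.ker) := by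
  have hker : P.ker ≤ (LinearMap.pi fun j => P.flip (y j)).ker := fun a ha =>
    funext fun j => LinearMap.congr_fun ha (y j)
  rw [← length_pi_residueField S n]
  refine Module.length_le_of_surjective (P.ker.liftQ _ hker) fun v => ?_
  choose w hw using fun i => residue_surjective (v i)
  refine ⟨Submodule.Quotient.mk (∑ i, w i • x i), funext fun j => ?_⟩
  rw [Submodule.liftQ_apply, LinearMap.pi_apply, LinearMap.flip_apply, map_sum,
    LinearMap.sum_apply]
  simp [h _ j, ← hw, Algebra.smul_def]

theorem IsDualPair.exists_isDualPair_succ {x : Fin n → X} {y : Fin n → Y}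
    (h : IsDualPair P x y) {a : X} (ha : ∀ j, P a (y j) = 0) (ha0 : P a ≠ 0) :
    ∃ x' y', IsDualPair (n := n + 1) P x' y' := by
  obtain ⟨b, hb⟩ : ∃ b, P a b ≠ 0 := by
    by_contra! hP
    exact ha0 (LinearMap.ext hP)
  obtain ⟨u, hu⟩ := residue_surjective (P a b)⁻¹
  choose w hw using fun i => residue_surjective (P (x i) (u • b))
  have smul_eq (s : S) (t : ResidueField S) : s • t = residue S s * t := Algebra.smul_def s t
  -- Gram-Schmidt: normalise `b` and make it orthogonal to all `x i`.
  refine ⟨Fin.cons a x, Fin.cons (u • b - ∑ i, w i • y i) y, fun i j => ?_⟩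
  cases i using Fin.cases <;> cases j using Fin.cases
  · simp [ha, smul_eq, hu, hb]
  · simp [ha, (Fin.succ_ne_zero _).symm]
  · simp [h _ _, smul_eq, hw]
  · simp [h _ _]

theorem IsDualPair.length_le {x : Fin n → X} {y : Fin n → Y} (h : IsDualPair P x y)
    (hn : ¬ ∃ x' y', IsDualPair (n := n + 1) P x' y') : Module.length S (X ⧸ P.ker) ≤ n := by
  have hker : (LinearMap.pi fun j => P.flip (y j)).ker ≤ P.ker := fun a ha => by
    by_contra ha0
    exact hn (h.exists_isDualPair_succ (fun j => congrFun ha j) ha0)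
  rw [← length_pi_residueField S n]
  refine (Module.length_le_of_surjective (Submodule.factor hker)
    (Submodule.factor_surjective hker)).trans ?_
  rw [(LinearMap.quotKerEquivRange _).length_eq]
  exact Module.length_le_of_injective (Submodule.subtype _) Subtype.val_injective

theorem dualRank_eq_length (P : X →ₗ[S] Y →ₗ[S] ResidueField S) :
    dualRank P = Module.length S (X ⧸ P.ker) := by
  refine le_antisymm (sSup_le ?_) ?_
  · rintro _ ⟨m, ⟨x, y, h⟩, rfl⟩
    exact h.le_length
  by_cases hmax : ∃ m, (∃ x y, IsDualPair (n := m) P x y) ∧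
      ¬ ∃ x y, IsDualPair (n := m + 1) P x y
  · obtain ⟨m, ⟨x, y, h⟩, hm⟩ := hmax
    exact (h.length_le hm).trans (le_sSup ⟨m, ⟨x, y, h⟩, rfl⟩)
  · push Not at hmax
    have hall (m : ℕ) : ∃ x y, IsDualPair (n := m) P x y := by
      induction m with
      | zero => exact ⟨Fin.elim0, Fin.elim0, fun i => i.elim0⟩
      | succ m ih => exact hmax m ih
    have htop : dualRank P = ⊤ := ENat.eq_top_iff_forall_ge.2 fun m => le_sSup ⟨m, hall m, rfl⟩
    exact htop ▸ le_top

end DualRank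

section DualSystem

open Module

variable {R M : Type*} [CommRing R] [AddCommGroup M] [Module R M] {n : ℕ}
  {φ : Fin n → M →ₗ[R] R} {m : Fin n → M}

/-- The submodules `⋂ ker φ_i, R m_1, …, R m_n`, which decompose `M` when the systems `φ` and `m`
are dual to each other. -/
def dualSummand (φ : Fin n → M →ₗ[R] R) (m : Fin n → M) : Fin (n + 1) → Submodule R M :=
  Fin.cons (⨅ i, (φ i).ker) fun j => Submodule.span R {m j}

theorem smul_mem_dualSummand_succ (i : Fin n) (r : R) : r • m i ∈ dualSummand φ m i.succ :=
  Submodule.smul_mem _ r (Submodule.mem_span_singleton_self (m i))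

theorem apply_eq_zero_of_mem_dualSummand (h : ∀ i j, φ i (m j) = if i = j then 1 else 0)
    {i : Fin n} {l : Fin (n + 1)} (hl : l ≠ i.succ) {x : M} (hx : x ∈ dualSummand φ m l) :
    φ i x = 0 := by
  cases l using Fin.cases with
  | zero => exact (Submodule.mem_iInf _).1 hx i
  | succ l =>
    obtain ⟨r, rfl⟩ := Submodule.mem_span_singleton.1 hx
    rw [map_smul, h, if_neg fun hil => hl (congrArg Fin.succ hil.symm), smul_zero]

theorem apply_smul_eq_of_mem_dualSummand_succ
    (h : ∀ i j, φ i (m j) = if i = j then 1 else 0) {i : Fin n} {x : M}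
    (hx : x ∈ dualSummand φ m i.succ) : φ i x • m i = x := by
  obtain ⟨r, rfl⟩ := Submodule.mem_span_singleton.1 hx
  rw [map_smul, h, if_pos rfl, smul_eq_mul, mul_one]

theorem isInternal_dualSummand (h : ∀ i j, φ i (m j) = if i = j then 1 else 0) :
    DirectSum.IsInternal (dualSummand φ m) := by
  refine (DirectSum.isInternal_submodule_iff_iSupIndep_and_iSup_eq_top _).2 ⟨?_, ?_⟩
  · rw [iSupIndep_iff_finsetSum_eq_zero_imp_eq_zero]
    intro s v hv hsum
    have hsucc (i : Fin n) (hi : i.succ ∈ s) : v i.succ = 0 := by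
      have hφ := congrArg (φ i) hsum
      rw [map_sum, map_zero, Finset.sum_eq_single_of_mem _ hi
        fun l hl hne => apply_eq_zero_of_mem_dualSummand h hne (hv l hl)] at hφ
      rw [← apply_smul_eq_of_mem_dualSummand_succ h (hv _ hi), hφ, zero_smul]
    intro l hl
    cases l using Fin.cases with
    | zero =>
      rwa [Finset.sum_eq_single_of_mem 0 hl fun l hl' hne => ?_] at hsum
      obtain ⟨i, rfl⟩ := Fin.exists_succ_eq.2 hne
      exact hsucc i hl'
    | succ i => exact hsucc i hl
  · refine eq_top_iff.2 fun x _ => ?_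
    have h0 : x - ∑ i, φ i x • m i ∈ dualSummand φ m 0 :=
      (Submodule.mem_iInf _).2 fun i => by simp [h]
    rw [← sub_add_cancel x (∑ i, φ i x • m i)]
    exact Submodule.add_mem _ (Submodule.mem_iSup_of_mem 0 h0) (Submodule.sum_mem _ fun i _ =>
      Submodule.mem_iSup_of_mem i.succ (smul_mem_dualSummand_succ i _))

/-- The coordinate `φ_i` is an isomorphism of the summand `R m_i` with `R`. -/
def dualSummandEquiv (h : ∀ i j, φ i (m j) = if i = j then 1 else 0) (i : Fin n) :
    dualSummand φ m i.succ ≃ₗ[R] R where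
  __ := (φ i).domRestrict (dualSummand φ m i.succ)
  invFun r := ⟨r • m i, smul_mem_dualSummand_succ i r⟩
  left_inv x := Subtype.ext (apply_smul_eq_of_mem_dualSummand_succ h x.2)
  right_inv r := (map_smul (φ i) r (m i)).trans (by rw [h, if_pos rfl, smul_eq_mul, mul_one])

variable [IsLocalRing R]

theorem exists_dual_of_residue_dual {D : Submodule R (M →ₗ[R] R)} (hφ : ∀ i, φ i ∈ D)
    (h : ∀ i j, residue R (φ i (m j)) = if i = j then 1 else 0) :
    ∃ ψ : Fin n → M →ₗ[R] R, (∀ i, ψ i ∈ D) ∧ ∀ i j, ψ i (m j) = if i = j then 1 else 0 := by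
  let A : Matrix (Fin n) (Fin n) R := .of fun i j => φ i (m j)
  have hA : IsUnit A.det := by
    have h1 : (residue R).mapMatrix A = 1 := by
      ext i j
      rw [RingHom.mapMatrix_apply, Matrix.map_apply, Matrix.one_apply]
      exact h i j
    refine isUnit_of_map_unit (residue R) _ ?_
    rw [RingHom.map_det, h1, Matrix.det_one]
    exact isUnit_one
  refine ⟨fun i => ∑ k, A⁻¹ i k • φ k,
    fun i => Submodule.sum_mem _ fun k _ => Submodule.smul_mem _ _ (hφ k), fun i j => ?_⟩
  rw [← Matrix.one_apply, ← Matrix.nonsing_inv_mul A hA, Matrix.mul_apply, LinearMap.sum_apply]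
  rfl

end DualSystem

namespace GradedCartierSubring

variable {p : ℕ} {R : Type*} [CommRing R] [Fact p.Prime] [CharP R p]
  {D : GradedCartierSubring p R} {e : ℕ}

theorem isDSummand_dualSummand {n : ℕ} {φ : Fin n → CartierMap p e R} (hφ : ∀ i, φ i ∈ D.deg e)
    {m : Fin n → FPush p e R} (h : ∀ i j, φ i (m j) = if i = j then 1 else 0) (i : Fin n) :
    D.IsDSummand e (dualSummand φ m) i.succ :=
  ⟨dualSummandEquiv h i, φ i, hφ i, fun _ => rfl,
    fun _ hl _ => apply_eq_zero_of_mem_dualSummand h hl⟩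

variable [IsLocalRing R]

variable (D e) in
/-- The pairing `(φ, x) ↦ φ(x) mod m` of `D_e` with `F^e_* R`. -/
noncomputable def evalPairing : D.deg e →ₗ[R] FPush p e R →ₗ[R] ResidueField R :=
  (Algebra.linearMap R (ResidueField R)).compRight R ∘ₗ (D.deg e).subtype

theorem IsDSummand.exists_isDualPair {k : ℕ} {M : Fin k → Submodule R (FPush p e R)}
    {s : Finset (Fin k)} (hs : ∀ j ∈ s, D.IsDSummand e M j) :
    ∃ x y, IsDualPair (X := D.deg e) (n := s.card) (D.evalPairing e) x y := by
  let ε := s.equivFin.symm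
  choose θ φ hφ hθ hzero using fun i : Fin s.card => hs (ε i) (ε i).2
  refine ⟨fun i => ⟨φ i, hφ i⟩, fun j => (θ j).symm 1, fun i j => ?_⟩
  change residue R (φ i ((θ j).symm 1)) = _
  split_ifs with hij
  · rw [← hij, hθ, LinearEquiv.apply_symm_apply, map_one]
  · rw [hzero i (ε j) (fun h => hij (ε.injective (Subtype.ext h)).symm) _ (Subtype.mem _),
      map_zero]

theorem splittingNumber_eq_dualRank :
    D.splittingNumber e = dualRank (X := D.deg e) (D.evalPairing e) := by
  refine congrArg sSup (Set.ext fun n => ⟨?_, ?_⟩)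
  · rintro ⟨k, M, s, -, hs, rfl⟩
    exact ⟨s.card, IsDSummand.exists_isDualPair hs, rfl⟩
  · rintro ⟨n, ⟨φ, m, h⟩, rfl⟩
    obtain ⟨ψ, hψ, hdual⟩ := exists_dual_of_residue_dual (fun i => (φ i).2) h
    refine ⟨n + 1, dualSummand ψ m, Finset.univ.map (Fin.succEmb n), isInternal_dualSummand hdual,
      fun j hj => ?_, by rw [Finset.card_map, Finset.card_fin]⟩
    obtain ⟨i, -, rfl⟩ := Finset.mem_map.1 hj
    exact isDSummand_dualSummand hψ hdual i

variable (D e) in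
/-- The ideal `I_e(D)` of all `r` with `φ(F^e_* r) ∈ m` for all `φ ∈ D_e`. -/
def splittingIdeal : Ideal R where
  carrier := {r | ∀ φ ∈ D.deg e, φ (FPush.of p e r) ∈ maximalIdeal R}
  zero_mem' φ _ := by rw [map_zero, map_zero]; exact Ideal.zero_mem _
  add_mem' ha hb φ hφ := by
    rw [map_add, map_add]
    exact Ideal.add_mem _ (ha φ hφ) (hb φ hφ)
  smul_mem' c _ hx φ hφ := hx (φ.premul c) (D.premul_mem hφ c)

theorem ker_flip_evalPairing :
    (D.evalPairing e).flip.ker = FPush.ideal p e (D.splittingIdeal e) := by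
  ext x
  exact ⟨fun h φ hφ => (residue_eq_zero_iff _).1 (LinearMap.congr_fun h ⟨φ, hφ⟩),
    fun h => LinearMap.ext fun φ => (residue_eq_zero_iff _).2 (h φ φ.2)⟩

theorem splittingNumber_eq_length : D.splittingNumber e =
    Module.length R (FPush p e R ⧸ FPush.ideal p e (D.splittingIdeal e)) := by
  rw [splittingNumber_eq_dualRank, ← dualRank_flip, dualRank_eq_length, ker_flip_evalPairing]

theorem splittingNumber_ne_top (hF : IsFFinite p R) : D.splittingNumber e ≠ ⊤ := by
  have := FPush.module_finite hF e
  have hle : (maximalIdeal R • ⊤ : Submodule R (FPush p e R)) ≤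
      FPush.ideal p e (D.splittingIdeal e) := fun x hx φ _ => apply_mem_of_mem_smul_top hx φ
  rw [splittingNumber_eq_length, Module.length_ne_top_iff]
  exact (isFiniteLength_quotient_maximalIdeal_smul_top R _).of_surjective
    (Submodule.factor_surjective hle)

theorem splittingNumber_div_rpow (hF : IsFFinite p R) :
    (D.splittingNumber e : ℝ≥0∞) / (p : ℝ≥0∞) ^ ((e : ℝ) * frobAlpha p R) =
      Module.length R (R ⧸ D.splittingIdeal e) := by
  rw [splittingNumber_eq_length, FPush.ideal,
    toENNReal_length_quotient_comap hF _ FPush.surjective_toRing]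
  exact ENNReal.mul_div_cancel_right (rpow_mul_frobAlpha_ne_zero p R e)
    (rpow_mul_frobAlpha_ne_top hF e)

theorem mem_semigroup_iff (hF : IsFFinite p R) : e ∈ D.semigroup ↔
    (D.splittingNumber e : ℝ≥0∞) / (p : ℝ≥0∞) ^ ((e : ℝ) * frobAlpha p R) ≠ 0 := by
  rw [Ne, ENNReal.div_eq_zero_iff, or_iff_left (rpow_mul_frobAlpha_ne_top hF e),
    ENat.toENNReal_eq_zero]
  rfl

theorem splittingNumber_div_rpow_add (d : ℕ) :
    (D.splittingNumber e : ℝ≥0∞) / (p : ℝ≥0∞) ^ ((e : ℝ) * ((d : ℝ) + frobAlpha p R)) =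
      D.splittingNumber e / (p : ℝ≥0∞) ^ ((e : ℝ) * frobAlpha p R) /
        (p : ℝ≥0∞) ^ ((e : ℝ) * d) := by
  have hp : (p : ℝ≥0∞) ≠ 0 := by exact_mod_cast (Fact.out : p.Prime).ne_zero
  rw [mul_add, add_comm, ENNReal.rpow_add _ _ hp (ENNReal.natCast_ne_top p), div_eq_mul_inv,
    ENNReal.mul_inv (.inl (rpow_mul_frobAlpha_ne_zero p R e))
      (.inr (ENNReal.rpow_pos (pos_iff_ne_zero.2 hp) (ENNReal.natCast_ne_top p)).ne'),
    ← mul_assoc, ← div_eq_mul_inv, ← div_eq_mul_inv]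

theorem splittingPrime_eq_iInf : D.splittingPrime = ⨅ e, ⨅ _ : 0 < e, D.splittingIdeal e := by
  ext r
  simp only [Submodule.mem_iInf]
  rfl

theorem isFPure_iff_splittingPrime_ne_top : D.IsFPure ↔ D.splittingPrime ≠ ⊤ := by
  constructor
  · rintro ⟨e, he, φ, hφ, hsurj⟩ htop
    obtain ⟨x, hx⟩ := hsurj 1
    have hmem : (FPush.of p e).symm x ∈ D.splittingPrime := htop ▸ Submodule.mem_top
    exact hx ▸ hmem e he φ hφ <| isUnit_one
  · intro hne
    by_contra hD
    refine hne ((Ideal.eq_top_iff_one _).2 fun e he φ hφ => ?_)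
    by_contra hunit
    obtain ⟨u, hu⟩ := notMem_maximalIdeal.1 hunit
    refine hD ⟨e, he, φ, hφ, fun r => ⟨(r * ↑u⁻¹) • FPush.of p e 1, ?_⟩⟩
    rw [map_smul, ← hu, smul_eq_mul, Units.inv_mul_cancel_right]

end GradedCartierSubring

section Colon

variable {p e : ℕ} {S : Type*} [CommRing S] [Fact p.Prime] [CharP S p]

namespace FGradedSystem

theorem premul_mem_cartier (b : FGradedSystem p S) (φ : CartierMap p e S) {c : S}
    (hc : c ∈ b.ideal e) : φ.premul c ∈ b.cartier.deg e :=
  Submodule.subset_span ⟨φ, c, hc, rfl⟩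

theorem splittingIdeal_cartier [IsLocalRing S] [Module.Free S (FPush p e S)]
    [Module.Finite S (FPush p e S)] (b : FGradedSystem p S) :
    b.cartier.splittingIdeal e =
      (frobPower p (maximalIdeal S) e).colon (b.ideal e : Set S) := by
  ext r
  refine ⟨fun h => Submodule.mem_colon.2 fun c hc => ?_, fun h => ?_⟩
  · rw [smul_eq_mul, mul_comm]
    exact mem_frobPower_of_forall_apply_mem fun φ => h _ (b.premul_mem_cartier φ hc)
  · suffices b.cartierDeg e ≤
        Submodule.comap (LinearMap.applyₗ (FPush.of p e r)) (maximalIdeal S) from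
      fun φ hφ => this hφ
    refine Submodule.span_le.2 ?_
    rintro _ ⟨φ, c, hc, rfl⟩
    have hrc : r * c ∈ frobPower p (maximalIdeal S) e := Submodule.mem_colon.1 h c hc
    rw [mul_comm] at hrc
    exact apply_mem_of_mem_frobPower φ hrc

end FGradedSystem

theorem CartierMap.IsGenerator.forall_apply_mul_mem_iff [Module.Free S (FPush p e S)]
    [Module.Finite S (FPush p e S)] {Φ : CartierMap p e S} (hΦ : Φ.IsGenerator) {I : Ideal S}
    {a : S} : (∀ x, Φ (FPush.of p e (a * x)) ∈ I) ↔ a ∈ frobPower p I e := by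
  refine ⟨fun h => mem_frobPower_of_forall_apply_mem fun φ => ?_,
    fun h x => apply_mem_of_mem_frobPower Φ (Ideal.mul_mem_right x _ h)⟩
  obtain ⟨c, rfl⟩ := hΦ φ
  rw [CartierMap.premul_of, mul_comm]
  exact h c

/-- The restriction of `FPush.toRing` to a map `F^e_* I → I`. -/
noncomputable def FPush.idealToRing (I : Ideal S) : ideal p e I →ₛₗ[iterateFrobenius S p e] I where
  toFun x := ⟨toRing p e S x, x.2⟩
  map_add' _ _ := rfl
  map_smul' _ _ := rfl

theorem FPush.surjective_idealToRing (I : Ideal S) :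
    Function.Surjective (idealToRing (p := p) (e := e) I) :=
  fun a => ⟨⟨of p e (a : S), a.2⟩, rfl⟩

/-- The pairing `(a, x) ↦ Φ(F^e_* (a x)) mod n` of `F^e_* I` with `F^e_* S`. -/
noncomputable def residuePairing [IsLocalRing S] (Φ : CartierMap p e S) (I : Ideal S) :
    FPush.ideal p e I →ₗ[S] FPush p e S →ₗ[S] ResidueField S :=
  (Φ.premulLinear.compr₂ (Algebra.linearMap S (ResidueField S))).domRestrict (FPush.ideal p e I)

section Kernels

variable [IsLocalRing S] [Module.Free S (FPush p e S)] [Module.Finite S (FPush p e S)]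
  {Φ : CartierMap p e S}

theorem ker_residuePairing (hΦ : Φ.IsGenerator) (I : Ideal S) :
    (residuePairing Φ I).ker =
      ((I ⊓ frobPower p (maximalIdeal S) e).submoduleOf I).comap (FPush.idealToRing I) := by
  ext a
  trans FPush.toRing p e S a ∈ frobPower p (maximalIdeal S) e
  · rw [← hΦ.forall_apply_mul_mem_iff, LinearMap.mem_ker, LinearMap.ext_iff]
    exact forall_congr' fun x => residue_eq_zero_iff _
  · exact ⟨fun h => ⟨a.2, h⟩, fun h => h.2⟩

theorem ker_flip_residuePairing (hΦ : Φ.IsGenerator) (I : Ideal S) :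
    (residuePairing Φ I).flip.ker =
      FPush.ideal p e ((frobPower p (maximalIdeal S) e).colon (I : Set S)) := by
  ext x
  obtain ⟨x, rfl⟩ := (FPush.of p e).surjective x
  rw [FPush.of_mem_ideal_iff, Submodule.mem_colon]
  refine ⟨fun h a ha => hΦ.forall_apply_mul_mem_iff.1 fun t => ?_,
    fun h => LinearMap.ext fun a => (residue_eq_zero_iff _).2 ?_⟩
  · have := LinearMap.congr_fun h ⟨FPush.of p e (a * t), I.mul_mem_right t ha⟩
    rw [smul_eq_mul, mul_assoc, mul_comm]
    exact (residue_eq_zero_iff _).1 this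
  · refine apply_mem_of_mem_frobPower Φ ?_
    rw [mul_comm]
    exact h _ a.2

end Kernels

theorem length_quotient_colon_frobPower [IsRegularLocalRing S] (hF : IsFFinite p S)
    (I : Ideal S) (e : ℕ) :
    Module.length S (S ⧸ (frobPower p (maximalIdeal S) e).colon (I : Set S)) =
      Module.length S (I ⧸ (I ⊓ frobPower p (maximalIdeal S) e).submoduleOf I) := by
  have := FPush.module_finite hF e
  have := FPush.module_free hF e
  obtain ⟨Φ, hΦ⟩ := exists_isGenerator hF e
  have h := congrArg ENat.toENNReal (dualRank_flip (residuePairing Φ I))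
  rw [dualRank_eq_length, dualRank_eq_length, ker_residuePairing hΦ, ker_flip_residuePairing hΦ,
    FPush.ideal, toENNReal_length_quotient_comap hF _ FPush.surjective_toRing,
    toENNReal_length_quotient_comap hF _ (FPush.surjective_idealToRing I)] at h
  exact ENat.toENNReal_inj.1 ((ENNReal.mul_left_inj (rpow_mul_frobAlpha_ne_zero p S e)
    (rpow_mul_frobAlpha_ne_top hF e)).1 h)

end Colon

section Conductor

namespace CartierMap

variable {p e l : ℕ} {S : Type*} [CommRing S] [Fact p.Prime] [CharP S p]

theorem premul_premul (φ : CartierMap p e S) (a b : S) :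
    (φ.premul a).premul b = φ.premul (a * b) := by
  ext x
  exact congrArg (φ ∘ FPush.of p e) (mul_assoc a b _).symm

theorem premul_right_comm (φ : CartierMap p e S) (a b : S) :
    (φ.premul a).premul b = (φ.premul b).premul a := by
  rw [premul_premul, premul_premul, mul_comm]

theorem premul_mul_premul (φ : CartierMap p e S) (ψ : CartierMap p l S) (a b : S) :
    (φ.premul a).mul (ψ.premul b) = (φ.mul ψ).premul (a ^ p ^ l * b) := by
  ext x
  obtain ⟨x, rfl⟩ := (FPush.of p (e + l)).surjective x
  rw [mul_of, premul_of, premul_of, premul_of, mul_of, mul_assoc, ← FPush.smul_of, map_smul,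
    smul_eq_mul]

/-- The map `F^e_* y ↦ χ(F^e_* (y • u))`, where `F^{e+l}_* S` is identified with
`F^e_* F^l_* S`. -/
noncomputable def contract (χ : CartierMap p (e + l) S) (u : FPush p l S) : CartierMap p e S where
  toFun y := χ (FPush.of p (e + l) ((FPush.of p l).symm ((FPush.of p e).symm y • u)))
  map_add' x y := by rw [map_add, add_smul, map_add, map_add, map_add]
  map_smul' r y := by
    obtain ⟨y, rfl⟩ := (FPush.of p e).surjective y
    obtain ⟨u, rfl⟩ := (FPush.of p l).surjective u
    rw [FPush.smul_of, AddEquiv.symm_apply_apply, AddEquiv.symm_apply_apply, FPush.smul_of,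
      FPush.smul_of, AddEquiv.symm_apply_apply, AddEquiv.symm_apply_apply, mul_pow, ← pow_mul,
      ← pow_add, mul_assoc, ← FPush.smul_of, map_smul, RingHom.id_apply]

theorem contract_mul_of (χ : CartierMap p (e + l) S) (u : FPush p l S) (ψ : CartierMap p l S)
    (x : S) : (χ.contract u).mul ψ (FPush.of p (e + l) x) =
      χ (FPush.of p (e + l) ((FPush.of p l).symm (ψ (FPush.of p l x) • u))) := rfl

theorem span_mul_eq_top [Module.Free S (FPush p l S)] [Module.Finite S (FPush p l S)] :
    Submodule.span S {χ : CartierMap p (e + l) S |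
      ∃ (φ : CartierMap p e S) (ψ : CartierMap p l S), χ = φ.mul ψ} = ⊤ := by
  refine eq_top_iff.2 fun χ _ => ?_
  let u := Module.Free.chooseBasis S (FPush p l S)
  have hχ : χ = ∑ i, (χ.contract (u i)).mul (u.coord i) := by
    ext x
    obtain ⟨x, rfl⟩ := (FPush.of p (e + l)).surjective x
    simp only [LinearMap.sum_apply, contract_mul_of, Module.Basis.coord_apply]
    rw [← map_sum, ← map_sum, ← map_sum, u.sum_repr, AddEquiv.symm_apply_apply]
  rw [hχ]
  exact Submodule.sum_mem _ fun i _ => Submodule.subset_span ⟨_, _, rfl⟩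

end CartierMap

namespace GradedCartierSubring

variable {p e : ℕ} {S : Type*} [CommRing S] [Fact p.Prime] [CharP S p]

theorem deg_injective :
    Function.Injective (deg : GradedCartierSubring p S → ∀ e, Submodule S (CartierMap p e S)) := by
  rintro ⟨_, _, _⟩ ⟨_, _, _⟩ rfl
  rfl

/-- The largest ideal `I` of `S` with `C^S_e · F^e_* I ⊆ D_e`. -/
def conductor (D : GradedCartierSubring p S) (e : ℕ) : Ideal S where
  carrier := {s | ∀ φ : CartierMap p e S, φ.premul s ∈ D.deg e}
  zero_mem' φ := by
    rw [← φ.premulLinear_of, map_zero, map_zero]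
    exact Submodule.zero_mem _
  add_mem' ha hb φ := by
    rw [← φ.premulLinear_of, map_add, map_add]
    exact Submodule.add_mem _ (ha φ) (hb φ)
  smul_mem' c _ hs φ := by
    rw [smul_eq_mul, ← φ.premul_premul]
    exact hs (φ.premul c)

theorem conductor_zero (D : GradedCartierSubring p S) : D.conductor 0 = ⊤ :=
  eq_top_iff.2 fun _ _ _ => D.deg_zero ▸ Submodule.mem_top

theorem frobPower_conductor_mul_le (D : GradedCartierSubring p S) (e l : ℕ)
    [Module.Free S (FPush p l S)] [Module.Finite S (FPush p l S)] :
    frobPower p (D.conductor e) l * D.conductor l ≤ D.conductor (e + l) := by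
  refine Ideal.mul_le.2 fun r hr t ht => ?_
  suffices h : frobPower p (D.conductor e) l ≤ (D.conductor (e + l)).colon {t} from
    Submodule.mem_colon_singleton.1 (h hr)
  refine Ideal.map_le_iff_le_comap.2 fun s hs => Submodule.mem_colon_singleton.2 fun χ => ?_
  have hχ := CartierMap.span_mul_eq_top.ge (Submodule.mem_top (x := χ))
  induction hχ using Submodule.span_induction with
  | mem _ h =>
    obtain ⟨φ, ψ, rfl⟩ := h
    exact φ.premul_mul_premul ψ s t ▸ D.mul_mem (hs φ) (ht ψ)
  | zero => exact Submodule.zero_mem _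
  | add _ _ _ _ h₁ h₂ => exact Submodule.add_mem _ h₁ h₂
  | smul c _ _ h => exact Submodule.smul_mem _ c h

theorem premul_mem_deg_iff {D : GradedCartierSubring p S} {Φ : CartierMap p e S}
    (hΦ : Φ.IsGenerator) {c : S} : Φ.premul c ∈ D.deg e ↔ c ∈ D.conductor e := by
  refine ⟨fun h φ => ?_, fun h => h Φ⟩
  obtain ⟨t, rfl⟩ := hΦ φ
  rw [CartierMap.premul_right_comm]
  exact D.premul_mem h t

end GradedCartierSubring

theorem CartierSubalgebra.exists_conductor_ne_bot {p : ℕ} {S : Type*} [CommRing S]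
    [IsRegularLocalRing S] [Fact p.Prime] [CharP S p] (hF : IsFFinite p S)
    (D : CartierSubalgebra p S) : ∃ e, 0 < e ∧ D.conductor e ≠ ⊥ := by
  obtain ⟨e, he, hne⟩ := D.exists_ne_bot
  obtain ⟨φ, hφ, hφ0⟩ := Submodule.exists_mem_ne_zero_of_ne_bot hne
  obtain ⟨Φ, hΦ⟩ := exists_isGenerator hF e
  obtain ⟨c, rfl⟩ := hΦ φ
  refine ⟨e, he, (Submodule.ne_bot_iff _).2
    ⟨c, (GradedCartierSubring.premul_mem_deg_iff hΦ).1 hφ, ?_⟩⟩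
  rintro rfl
  rw [← Φ.premulLinear_of, map_zero, map_zero] at hφ0
  exact hφ0 rfl

theorem CartierSubalgebra.exists_cartier_eq {p : ℕ} {S : Type*} [CommRing S]
    [IsRegularLocalRing S] [Fact p.Prime] [CharP S p] (hF : IsFFinite p S)
    (D : CartierSubalgebra p S) :
    ∃ b : FGradedSystem p S, b.cartier = D.toGradedCartierSubring := by
  have := FPush.module_finite hF
  have := FPush.module_free hF
  refine ⟨⟨D.conductor, D.conductor_zero, D.exists_conductor_ne_bot hF,
    fun e l => D.frobPower_conductor_mul_le e l⟩,
    GradedCartierSubring.deg_injective (funext fun e => le_antisymm ?_ fun φ hφ => ?_)⟩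
  · refine Submodule.span_le.2 ?_
    rintro _ ⟨φ, c, hc, rfl⟩
    exact hc φ
  · obtain ⟨Φ, hΦ⟩ := exists_isGenerator hF e
    obtain ⟨c, rfl⟩ := hΦ φ
    exact FGradedSystem.premul_mem_cartier _ _ ((GradedCartierSubring.premul_mem_deg_iff hΦ).1 hφ)

end Conductor

section Lift

variable {p e l : ℕ} {S R : Type*} [CommRing S] [CommRing R] [Algebra S R] [Fact p.Prime]
  [CharP S p] [CharP R p]

namespace CartierMap

/-- `φ` on `S` is compatible with `ψ` on the `S`-algebra `R`: if `S → R` is surjective, then `ψ`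
is the map induced by `φ`. -/
def Induces (φ : CartierMap p e S) (ψ : CartierMap p e R) : Prop :=
  ∀ x : S, ψ (FPush.of p e (algebraMap S R x)) = algebraMap S R (φ (FPush.of p e x))

namespace Induces

variable {φ φ' : CartierMap p e S} {ψ ψ' : CartierMap p e R}

theorem zero : Induces (0 : CartierMap p e S) (0 : CartierMap p e R) :=
  fun _ => (map_zero (algebraMap S R)).symm

theorem add (h : Induces φ ψ) (h' : Induces φ' ψ') : Induces (φ + φ') (ψ + ψ') := fun x => by
  rw [LinearMap.add_apply, LinearMap.add_apply, h, h', map_add]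

theorem smul (h : Induces φ ψ) (r : S) : Induces (r • φ) (algebraMap S R r • ψ) := fun x => by
  rw [LinearMap.smul_apply, LinearMap.smul_apply, h, smul_eq_mul, smul_eq_mul, map_mul]

theorem mul {χ : CartierMap p l S} {ω : CartierMap p l R} (h : Induces φ ψ)
    (h' : Induces χ ω) : Induces (φ.mul χ) (ψ.mul ω) := fun x => by
  rw [mul_of, mul_of, h', h]

theorem unique (hSR : Function.Surjective (algebraMap S R)) (h : Induces φ ψ)
    (h' : Induces φ ψ') : ψ = ψ' := by
  ext x
  obtain ⟨x, rfl⟩ := (FPush.of p e).surjective x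
  obtain ⟨x, rfl⟩ := hSR x
  rw [h x, h' x]

end Induces

theorem exists_induces_of_projective [Module.Projective S (FPush p e S)]
    (hSR : Function.Surjective (algebraMap S R)) (ψ : CartierMap p e R) :
    ∃ φ : CartierMap p e S, Induces φ ψ := by
  let g : FPush p e S →ₗ[S] R :=
    { toFun := fun x => ψ (FPush.of p e (algebraMap S R (FPush.toRing p e S x)))
      map_add' := fun x y => by simp only [map_add]
      map_smul' := fun r x => by
        rw [map_smulₛₗ, smul_eq_mul, map_mul, iterateFrobenius_def, map_pow, ← FPush.smul_of,
          map_smul, algebraMap_smul, RingHom.id_apply] }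
  obtain ⟨φ, hφ⟩ := Module.projective_lifting_property (Algebra.linearMap S R) g hSR
  exact ⟨φ, fun x => (LinearMap.congr_fun hφ (FPush.of p e x)).symm⟩

theorem exists_induces_zero (R : Type*) [CommRing R] [Algebra S R] [CharP R p]
    (φ : CartierMap p 0 S) : ∃ ψ : CartierMap p 0 R, Induces φ ψ := by
  let ψ : CartierMap p 0 R :=
    { toFun := fun x => FPush.toRing p 0 R x * algebraMap S R (φ (FPush.of p 0 1))
      map_add' := fun x y => by rw [map_add, add_mul]
      map_smul' := fun r x => by
        rw [map_smulₛₗ, iterateFrobenius_zero_apply, RingHom.id_apply, smul_mul_assoc] }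
  refine ⟨ψ, fun x => ?_⟩
  have hx : x • FPush.of p 0 (1 : S) = FPush.of p 0 x := by
    rw [FPush.smul_of, pow_zero, pow_one, mul_one]
  rw [← hx, map_smul, smul_eq_mul, map_mul]
  rfl

end CartierMap

namespace GradedCartierSubring

variable (D : GradedCartierSubring p R)

variable (S) in
/-- The graded subring of all maps on `S` that induce an element of `D`. -/
def lift : GradedCartierSubring p S where
  deg e :=
    { carrier := {φ | ∃ ψ ∈ D.deg e, φ.Induces ψ}
      zero_mem' := ⟨0, Submodule.zero_mem _, .zero⟩
      add_mem' := fun ⟨ψ, hψ, h⟩ ⟨ψ', hψ', h'⟩ =>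
        ⟨ψ + ψ', Submodule.add_mem _ hψ hψ', h.add h'⟩
      smul_mem' := fun r _ ⟨_, hψ, h⟩ => ⟨_, Submodule.smul_mem _ _ hψ, h.smul r⟩ }
  deg_zero := eq_top_iff.2 fun φ _ =>
    have ⟨ψ, h⟩ := φ.exists_induces_zero R
    ⟨ψ, D.deg_zero ▸ Submodule.mem_top, h⟩
  mul_mem := fun ⟨_, hψ, h⟩ ⟨_, hψ', h'⟩ => ⟨_, D.mul_mem hψ hψ', h.mul h'⟩

theorem exists_mem_lift_of_mem_deg [Module.Projective S (FPush p e S)]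
    (hSR : Function.Surjective (algebraMap S R)) {ψ : CartierMap p e R} (hψ : ψ ∈ D.deg e) :
    ∃ φ ∈ (D.lift S).deg e, φ.Induces ψ := by
  obtain ⟨φ, h⟩ := CartierMap.exists_induces_of_projective hSR ψ
  exact ⟨φ, ⟨ψ, hψ, h⟩, h⟩

theorem mem_deg_iff_exists_mem_lift [Module.Projective S (FPush p e S)]
    (hSR : Function.Surjective (algebraMap S R)) (ψ : CartierMap p e R) :
    ψ ∈ D.deg e ↔ ∃ φ ∈ (D.lift S).deg e, φ.Induces ψ := by
  refine ⟨D.exists_mem_lift_of_mem_deg hSR, ?_⟩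
  rintro ⟨φ, ⟨ψ', hψ', h'⟩, h⟩
  rwa [h.unique hSR h']

theorem lift_deg_ne_bot [Module.Projective S (FPush p e S)]
    (hSR : Function.Surjective (algebraMap S R)) (hD : D.deg e ≠ ⊥) :
    (D.lift S).deg e ≠ ⊥ := by
  obtain ⟨ψ, hψ, hψ0⟩ := Submodule.exists_mem_ne_zero_of_ne_bot hD
  obtain ⟨φ, hφ, h⟩ := D.exists_mem_lift_of_mem_deg hSR hψ
  refine (Submodule.ne_bot_iff _).2 ⟨φ, hφ, ?_⟩
  rintro rfl
  exact hψ0 (h.unique hSR .zero)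

theorem ideal_le_colon_frobPower [Module.Free S (FPush p e S)] [Module.Finite S (FPush p e S)]
    {b : FGradedSystem p S} (hb : b.cartier = D.lift S) :
    b.ideal e ≤ (frobPower p (RingHom.ker (algebraMap S R)) e).colon
      (RingHom.ker (algebraMap S R) : Set S) := by
  refine fun c hc => Submodule.mem_colon.2 fun j hj => mem_frobPower_of_forall_apply_mem fun φ => ?_
  obtain ⟨ψ, -, h⟩ : φ.premul c ∈ (D.lift S).deg e := hb ▸ b.premul_mem_cartier φ hc
  have hj' := h j
  rw [(RingHom.mem_ker).1 hj, map_zero, map_zero] at hj'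
  exact hj'.symm

variable [IsLocalRing S] [IsLocalRing R]

theorem comap_splittingIdeal [Module.Projective S (FPush p e S)]
    (hSR : Function.Surjective (algebraMap S R)) :
    (D.splittingIdeal e).comap (algebraMap S R) = (D.lift S).splittingIdeal e := by
  have : IsLocalHom (algebraMap S R) := .of_surjective _ hSR
  ext r
  refine ⟨fun h φ => ?_, fun h ψ hψ => ?_⟩
  · rintro ⟨ψ, hψ, hφψ⟩
    rw [← maximalIdeal_comap (algebraMap S R), Ideal.mem_comap, ← hφψ]
    exact h ψ hψ
  · obtain ⟨φ, hφ, hφψ⟩ := D.exists_mem_lift_of_mem_deg hSR hψ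
    have hφr := h φ hφ
    rwa [← maximalIdeal_comap (algebraMap S R), Ideal.mem_comap, ← hφψ] at hφr

theorem splittingNumber_lift_div_rpow [Module.Projective S (FPush p e S)]
    (hSR : Function.Surjective (algebraMap S R)) (hF : IsFFinite p S) :
    (D.splittingNumber e : ℝ≥0∞) / (p : ℝ≥0∞) ^ ((e : ℝ) * frobAlpha p R) =
      (D.lift S).splittingNumber e / (p : ℝ≥0∞) ^ ((e : ℝ) * frobAlpha p S) := by
  let g : S →ₗ[S] R ⧸ D.splittingIdeal e :=
    ((D.splittingIdeal e).mkQ.restrictScalars S).comp (Algebra.linearMap S R)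
  have hg : Function.Surjective g := (D.splittingIdeal e).mkQ_surjective.comp hSR
  have hker : g.ker = (D.lift S).splittingIdeal e := by
    rw [← D.comap_splittingIdeal hSR]
    ext x
    exact Ideal.Quotient.eq_zero_iff_mem
  rw [splittingNumber_div_rpow (isFFinite_of_surjective hSR hF), splittingNumber_div_rpow hF,
    ← Module.length_eq_of_surjective hSR, ← hker, (g.quotKerEquivOfSurjective hg).length_eq]

variable [∀ e, Module.Projective S (FPush p e S)]

theorem comap_splittingPrime (hSR : Function.Surjective (algebraMap S R)) :
    D.splittingPrime.comap (algebraMap S R) = (D.lift S).splittingPrime := by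
  simp only [splittingPrime_eq_iInf, Ideal.comap_iInf, D.comap_splittingIdeal hSR]

theorem isFPure_lift_iff (hSR : Function.Surjective (algebraMap S R)) :
    D.IsFPure ↔ (D.lift S).IsFPure := by
  rw [isFPure_iff_splittingPrime_ne_top, isFPure_iff_splittingPrime_ne_top,
    ← D.comap_splittingPrime hSR, Ne, Ne, Ideal.comap_eq_top_iff]

theorem splittingDim_lift (hSR : Function.Surjective (algebraMap S R)) :
    D.splittingDim = (D.lift S).splittingDim := by
  let g := (Ideal.Quotient.mk D.splittingPrime).comp (algebraMap S R)
  have hg : Function.Surjective g := Ideal.Quotient.mk_surjective.comp hSR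
  have hker : RingHom.ker g = (D.lift S).splittingPrime := by
    rw [← D.comap_splittingPrime hSR, ← RingHom.comap_ker, Ideal.mk_ker]
  rw [splittingDim, splittingDim, ← hker]
  exact (ringKrullDim_eq_of_ringEquiv (RingHom.quotientKerEquivOfSurjective hg)).symm

theorem isSplittingRatio_lift_iff (hSR : Function.Surjective (algebraMap S R))
    (hF : IsFFinite p S) (r : ℝ≥0∞) : D.IsSplittingRatio r ↔ (D.lift S).IsSplittingRatio r := by
  have hratio : ∀ e, _ := fun e => D.splittingNumber_lift_div_rpow (e := e) hSR hF
  have hsemigroup : D.semigroup = (D.lift S).semigroup := Set.ext fun e => by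
    rw [mem_semigroup_iff (isFFinite_of_surjective hSR hF), mem_semigroup_iff hF, hratio]
  simp only [IsSplittingRatio, hsemigroup, splittingNumber_div_rpow_add, hratio,
    D.splittingDim_lift hSR]

end GradedCartierSubring

end Lift

theorem theorem4p9 {S : Type*} [CommRing S] [IsRegularLocalRing S] (p : ℕ) [Fact p.Prime]
    [CharP S p] (hF : IsFFinite p S) (J : Ideal S) [Nontrivial (S ⧸ J)]
    (D : CartierSubalgebra p (S ⧸ J)) :
    ∃ b : FGradedSystem p S,
      -- the graded Cartier algebra of `b` is a Cartier subalgebra on `S`, and it induces `D`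
      (∃ e, 0 < e ∧ b.cartier.deg e ≠ ⊥) ∧
      (∀ (e : ℕ) (ψ : CartierMap p e (S ⧸ J)), ψ ∈ D.deg e ↔
        ∃ φ ∈ b.cartier.deg e, ∀ x : S,
          ψ (FPush.of p e (Ideal.Quotient.mk J x)) =
            Ideal.Quotient.mk J (φ (FPush.of p e x))) ∧
      -- the containment and the splitting numbers
      (∀ e : ℕ, 0 < e →
        b.ideal e ≤ (frobPower p J e).colon (J : Set S) ∧
        D.splittingNumber e ≠ ⊤ ∧ b.cartier.splittingNumber e ≠ ⊤ ∧
        (D.splittingNumber e : ℝ≥0∞) / (p : ℝ≥0∞) ^ ((e : ℝ) * frobAlpha p (S ⧸ J)) =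
          (b.cartier.splittingNumber e : ℝ≥0∞) / (p : ℝ≥0∞) ^ ((e : ℝ) * frobAlpha p S) ∧
        (b.cartier.splittingNumber e : ℝ≥0∞) / (p : ℝ≥0∞) ^ ((e : ℝ) * frobAlpha p S) =
          (Module.length S
            (S ⧸ (frobPower p (maximalIdeal S) e).colon (b.ideal e : Set S)) : ℝ≥0∞) ∧
        Module.length S (S ⧸ (frobPower p (maximalIdeal S) e).colon (b.ideal e : Set S)) =
          Module.length S (b.ideal e ⧸
            (b.ideal e ⊓ frobPower p (maximalIdeal S) e).submoduleOf (b.ideal e))) ∧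
      -- the splitting prime
      D.splittingPrime = b.cartier.splittingPrime.map (Ideal.Quotient.mk J) ∧
      b.cartier.splittingPrime =
        ⨅ e : {e : ℕ // 0 < e},
          (frobPower p (maximalIdeal S) e).colon (b.ideal e : Set S) ∧
      -- the splitting dimension and the splitting ratio
      (D.IsFPure ↔ b.cartier.IsFPure) ∧
      (D.IsFPure → D.splittingDim = b.cartier.splittingDim ∧
        ∀ r : ℝ≥0∞, D.IsSplittingRatio r ↔ b.cartier.IsSplittingRatio r) := by
  have := FPush.module_finite hF
  have := FPush.module_free hF
  have hJ : Function.Surjective (algebraMap S (S ⧸ J)) := Ideal.Quotient.mk_surjective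
  have hker : RingHom.ker (algebraMap S (S ⧸ J)) = J := Ideal.mk_ker
  have hne : ∃ e, 0 < e ∧ (D.lift S).deg e ≠ ⊥ :=
    D.exists_ne_bot.imp fun _ ⟨he, hDe⟩ => ⟨he, D.lift_deg_ne_bot hJ hDe⟩
  obtain ⟨b, hb⟩ := CartierSubalgebra.exists_cartier_eq hF ⟨D.lift S, hne⟩
  refine ⟨b, hb ▸ hne, fun e ψ => hb ▸ D.mem_deg_iff_exists_mem_lift hJ ψ, fun e _ =>
    ⟨hker ▸ D.ideal_le_colon_frobPower hb,
      GradedCartierSubring.splittingNumber_ne_top (isFFinite_of_surjective hJ hF),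
      GradedCartierSubring.splittingNumber_ne_top hF,
      hb ▸ D.splittingNumber_lift_div_rpow hJ hF,
      b.splittingIdeal_cartier ▸ GradedCartierSubring.splittingNumber_div_rpow hF,
      length_quotient_colon_frobPower hF (b.ideal e) e⟩, ?_, ?_,
    hb ▸ D.isFPure_lift_iff hJ,
    fun _ => hb ▸ ⟨D.splittingDim_lift hJ, D.isSplittingRatio_lift_iff hJ hF⟩⟩
  · rw [hb, ← D.comap_splittingPrime hJ]
    exact (Ideal.map_comap_of_surjective _ hJ _).symm
  · simp only [GradedCartierSubring.splittingPrime_eq_iInf, b.splittingIdeal_cartier, iInf_subtype]
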